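/- Let $L>0$, $k>0$, $0<\theta<\pi/2$, and $\nu=e^{ikL\cos\theta}$. Let $f:\mathbb R\to\mathbb R$ be Lipschitz continuous and $L$-periodic, and put $$D=\{(x,y)\in\mathbb R^2: y\ge f(x)\},\qquad D_L=\{(x,y)\in D: 0\le x\le L\},\qquad S=\partial D=\{(x,y): y=f(x)\}.$$ Let $w:D\to\mathbb C$ be a function with $w\in L^2(D_L)$ that is a weak solution of the quasiperiodic Dirichlet problem $$(\Delta+k^2)w=0\ \text{ in } D,\qquad w=0\ \text{ on } S,$$ $$w(x+L,y)=\nu\,w(x,y),\qquad w_x(x+L,y)=\nu\,w_x(x,y)\qquad\text{for almost every }(x,y)\in D.$$ This means that $w$ has weak partial derivatives $w_x,w_y$ in the interior $D^\circ$ of $D$, that $w,w_x,w_y\in L^2(D\cap K)$ for every compact $K\subset\mathbb R^2$, that $$\int_D (w_x\varphi_x+w_y\varphi_y)\,dx\,dy=k^2\int_D w\,\varphi\,dx\,dy\qquad\text{for all }\varphi\in C_c^\infty(D^\circ),$$ and that $w$ vanishes on $S$ in the $H^1$ sense: for every compact $K\subset\mathbb R^2$, $w$ is the limit in $H^1(D\cap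 K)$ of functions in $C_c^\infty(D^\circ)$. Then $w=0$ almost everywhere in $D$. -/

import Mathlib

open MeasureTheory
open scoped ContDiff ENNReal

namespace PeriodicGrating

/-- The closed region `D = {(x, y) : y ≥ f x}` above the graph of `f`. -/
def region (f : ℝ → ℝ) : Set (ℝ × ℝ) := {p | f p.1 ≤ p.2}

/-- One period cell `D_L = {(x, y) ∈ D : 0 ≤ x ≤ L}`. -/
def cell (f : ℝ → ℝ) (L : ℝ) : Set (ℝ × ℝ) := {p | p ∈ region f ∧ 0 ≤ p.1 ∧ p.1 ≤ L}

/-- The (classical) partial derivative `∂φ/∂x`. -/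
noncomputable def dx (φ : ℝ × ℝ → ℂ) (p : ℝ × ℝ) : ℂ := fderiv ℝ φ p (1, 0)

/-- The (classical) partial derivative `∂φ/∂y`. -/
noncomputable def dy (φ : ℝ × ℝ → ℂ) (p : ℝ × ℝ) : ℂ := fderiv ℝ φ p (0, 1)

/-- `φ ∈ C_c^∞(U)`. -/
structure IsTestFunction (U : Set (ℝ × ℝ)) (φ : ℝ × ℝ → ℂ) : Prop where
  smooth : ContDiff ℝ ∞ φ
  compact : HasCompactSupport φ
  support : tsupport φ ⊆ U

/-- `u` is square integrable on every bounded piece of `D` (up to the boundary of `D`). -/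
def LocallyL2 (f : ℝ → ℝ) (u : ℝ × ℝ → ℂ) : Prop :=
  ∀ K : Set (ℝ × ℝ), IsCompact K → MemLp u 2 (volume.restrict (region f ∩ K))

/-- `w` is in `H¹` of every bounded piece of `D`, with weak partial derivatives
`w_x = gx` and `w_y = gy` in the interior of `D`. -/
structure HasWeakGradient (f : ℝ → ℝ) (w gx gy : ℝ × ℝ → ℂ) : Prop where
  memL2 : LocallyL2 f w
  memL2_x : LocallyL2 f gx
  memL2_y : LocallyL2 f gy
  weak_x : ∀ φ : ℝ × ℝ → ℂ, IsTestFunction (interior (region f)) φ →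
    ∫ p in region f, w p * dx φ p = -∫ p in region f, gx p * φ p
  weak_y : ∀ φ : ℝ × ℝ → ℂ, IsTestFunction (interior (region f)) φ →
    ∫ p in region f, w p * dy φ p = -∫ p in region f, gy p * φ p

/-- `w = 0` on the boundary graph, in the sense of `H¹`: on every compact set (which may meet the
boundary of `D`), `w` is an `H¹`-limit of functions in `C_c^∞(int D)`. Here `(gx, gy)` is the weak
gradient of `w`. -/
def VanishesOnBoundary (f : ℝ → ℝ) (w gx gy : ℝ × ℝ → ℂ) : Prop :=
  ∀ K : Set (ℝ × ℝ), IsCompact K → ∀ ε : ℝ≥0∞, 0 < ε →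
    ∃ φ : ℝ × ℝ → ℂ, IsTestFunction (interior (region f)) φ ∧
      eLpNorm (fun p => w p - φ p) 2 (volume.restrict (region f ∩ K)) ≤ ε ∧
      eLpNorm (fun p => gx p - dx φ p) 2 (volume.restrict (region f ∩ K)) ≤ ε ∧
      eLpNorm (fun p => gy p - dy φ p) 2 (volume.restrict (region f ∩ K)) ≤ ε

/-- The weak form of `(Δ + k²) w = 0` in `D`, for `w` with weak gradient `(gx, gy)`. -/
def SolvesHelmholtz (f : ℝ → ℝ) (k : ℝ) (w gx gy : ℝ × ℝ → ℂ) : Prop :=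
  ∀ φ : ℝ × ℝ → ℂ, IsTestFunction (interior (region f)) φ →
    ∫ p in region f, (gx p * dx φ p + gy p * dy φ p) =
      (k : ℂ) ^ 2 * ∫ p in region f, w p * φ p

/-- `u (x + L, y) = ν u (x, y)` for almost every `(x, y) ∈ D`. -/
def Quasiperiodic (f : ℝ → ℝ) (L : ℝ) (ν : ℂ) (u : ℝ × ℝ → ℂ) : Prop :=
  ∀ᵐ p ∂(volume.restrict (region f)), u (p.1 + L, p.2) = ν * u p

end PeriodicGrating

/-!
The region is invariant under upward translation, so an upward translate of `w` (extended by zero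
below the graph) may be tested against the equation for `w` itself. Write `W`, `Wx`, `Wy` for the
zero extensions, multiplied by the square root of a cutoff `χ(x)` whose translates by multiples of
`L` sum to one; integrals against `χ` are then integrals over one period. Testing with `χ(x)` times
the conjugate of `w(x, y - h)`, `h ≥ 0`, gives, in `L²(ℝ²)` and with `Tₕ F (x, y) = F (x, y - h)`,
`⟪Tₕ Wx, Wx⟫ + ⟪Tₕ Wy, Wy⟫ = k² ⟪Tₕ W, W⟫`,
the term containing `χ'` being zero by quasiperiodicity. Taking conjugates and translating, the
identity holds for every real `h` (`IsGratingSolution.gram_identity`). Since `w` is only assumed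
square integrable over a period, the square integrability of its gradient comes first, from a
Caccioppoli estimate, the same identity with `h = 0` and a cutoff in `y`
(`IsGratingSolution.exists_bound_height_mul_weighted`).

The identity says that `‖∑ cₜ Tₜ Wy‖ ≤ k ‖∑ cₜ Tₜ W‖` for all finite sums, so there is a bounded
operator `B` with `B (Tₜ W) = Tₜ Wy`. As `Tₜ W` has the weak derivative `-Tₜ Wy` in `t`
(`IsGratingSolution.hasDerivAt_inner_translate`), all derivatives of `t ↦ ⟪v, Tₜ W⟫` are of the same
form, with `(-B*)ⁿ v` in place of `v`, and the `n`-th one is bounded by a constant times `kⁿ`. Such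
a function vanishes identically if it vanishes on a half-line (`inner_eq_zero_of_gram`). Take for `v`
the restriction of `W` to `{y ≤ R}`: as `f` is bounded below, `Tₜ W` is supported in `{y > R}` for
large `t`, so the inner product vanishes for all `t`, and at `t = 0` it is `∫_{y ≤ R} |W|²`.

In spectral terms: the Fourier transform of `W` in `y` is supported in `[-k, k]`, and a nonzero
band-limited function does not vanish on a half-line.
-/

namespace PeriodicGrating
open Filter Topology ComplexConjugate

/-! ### Functions with exponentially bounded derivatives -/

/-- If every derivative of a function is bounded on the line by a constant times `k ^ n` and the
function vanishes on a half-line, then it vanishes: on an interval of length `1 / (2 (k + 1))`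
adjacent to the half-line, applying the mean value inequality `m` times bounds each derivative by a
multiple of `2⁻ᵐ`. -/
theorem eq_zero_of_deriv_bounds {F : ℕ → ℝ → ℂ} {C k h₀ : ℝ} (hk : 0 ≤ k) (hC : 0 ≤ C)
    (hd : ∀ n t, HasDerivAt (F n) (F (n + 1) t) t) (hb : ∀ n t, ‖F n t‖ ≤ C * k ^ n)
    (hz : ∀ t, h₀ < t → F 0 t = 0) (t : ℝ) : F 0 t = 0 := by
  have hzn : ∀ n t, h₀ < t → F n t = 0 := by
    intro n
    induction n with
    | zero => exact hz
    | succ n ih =>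
      intro t ht
      have h1 : F n =ᶠ[𝓝 t] fun _ => 0 := by
        filter_upwards [Ioi_mem_nhds ht] with s hs using ih s hs
      exact (hd n t).unique ((hasDerivAt_const t (0 : ℂ)).congr_of_eventuallyEq h1)
  set δ : ℝ := 1 / (2 * (k + 1)) with hδ
  have hδ0 : 0 < δ := by positivity
  have hkδ : k * δ ≤ 1 / 2 := by
    rw [hδ, mul_one_div, div_le_div_iff₀ (by positivity) (by norm_num)]; linarith
  -- vanishing on a half-line propagates by the fixed step `δ`
  have step : ∀ a : ℝ, (∀ n t, a ≤ t → F n t = 0) → ∀ n t, a - δ ≤ t → F n t = 0 := by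
    intro a ha
    have key : ∀ m n t, a - δ ≤ t → ‖F n t‖ ≤ C * k ^ n * (1 / 2) ^ m := by
      intro m
      induction m with
      | zero => intro n t _; simpa using hb n t
      | succ m ih =>
        intro n t ht
        rcases le_total a t with hat | hta
        · rw [ha n t hat]; simp; positivity
        · have h2 := (convex_Icc (a - δ) a).norm_image_sub_le_of_norm_hasDerivWithin_le
            (f := F n) (f' := F (n + 1)) (C := C * k ^ (n + 1) * (1 / 2) ^ m)
            (fun x _ => (hd n x).hasDerivWithinAt)
            (fun x hx => ih (n + 1) x hx.1)
            (x := a) (y := t) ⟨by linarith, le_rfl⟩ ⟨ht, hta⟩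
          rw [ha n a le_rfl, sub_zero, Real.norm_eq_abs, abs_of_nonpos (by linarith)] at h2
          have h3 : -(t - a) ≤ δ := by linarith
          calc ‖F n t‖ ≤ C * k ^ (n + 1) * (1 / 2) ^ m * δ :=
                h2.trans (by gcongr)
            _ = C * k ^ n * (1 / 2) ^ m * (k * δ) := by ring
            _ ≤ C * k ^ n * (1 / 2) ^ m * (1 / 2) := by gcongr
            _ = _ := by ring
    intro n t ht
    have hlim : Tendsto (fun m : ℕ => C * k ^ n * (1 / 2 : ℝ) ^ m) atTop (𝓝 0) := by
      simpa using (tendsto_pow_atTop_nhds_zero_of_lt_one (by norm_num : (0 : ℝ) ≤ 1 / 2)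
        (by norm_num)).const_mul (C * k ^ n)
    exact norm_le_zero_iff.1 (ge_of_tendsto' hlim fun m => key m n t ht)
  have all : ∀ j : ℕ, ∀ n t, h₀ + 1 - j * δ ≤ t → F n t = 0 := by
    intro j
    induction j with
    | zero => intro n t ht; exact hzn n t (by simp at ht; linarith)
    | succ j ih =>
      intro n t ht
      refine step _ ih n t ?_
      push_cast at ht; linarith
  obtain ⟨j, hj⟩ := exists_nat_gt ((h₀ + 1 - t) / δ)
  refine all j 0 t ?_
  rw [div_lt_iff₀ hδ0] at hj
  linarith

/-! ### A curve in Hilbert space controlled by its Gram matrix -/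

section Hilbert
variable {H : Type*} [NormedAddCommGroup H] [InnerProductSpace ℂ H] [CompleteSpace H]

/-- The identity between Gram matrices makes `∑ cₜ u t ↦ ∑ cₜ q t` well defined and bounded by `k`
on the span of the `u t`. It is extended to the closure of the span by continuity, and to the whole
space through the orthogonal projection. -/
theorem exists_clm_of_gram {u p q : ℝ → H} {k : ℝ} (hk : 0 ≤ k)
    (hG : ∀ s t, inner ℂ (p s) (p t) + inner ℂ (q s) (q t) = (k : ℂ) ^ 2 * inner ℂ (u s) (u t)) :
    ∃ B : H →L[ℂ] H, ‖B‖ ≤ k ∧ ∀ t, B (u t) = q t := by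
  set eu := Finsupp.linearCombination ℂ u with heu
  set eq := Finsupp.linearCombination ℂ q with heq
  have hsq : ∀ c : ℝ →₀ ℂ, ‖eq c‖ ^ 2 ≤ k ^ 2 * ‖eu c‖ ^ 2 := by
    intro c
    have h1 : inner ℂ (Finsupp.linearCombination ℂ p c) (Finsupp.linearCombination ℂ p c)
        + inner ℂ (eq c) (eq c) = (k : ℂ) ^ 2 * inner ℂ (eu c) (eu c) := by
      simp only [heu, heq, Finsupp.linearCombination_apply, Finsupp.sum, sum_inner, inner_sum,
        inner_smul_left, inner_smul_right, Finset.mul_sum, ← Finset.sum_add_distrib]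
      refine Finset.sum_congr rfl fun s _ => Finset.sum_congr rfl fun t _ => ?_
      linear_combination ((starRingEnd ℂ) (c t) * c s) * hG t s
    rw [inner_self_eq_norm_sq_to_K, inner_self_eq_norm_sq_to_K, inner_self_eq_norm_sq_to_K] at h1
    have h2 : ‖Finsupp.linearCombination ℂ p c‖ ^ 2 + ‖eq c‖ ^ 2 = k ^ 2 * ‖eu c‖ ^ 2 := by
      have h3 : ((‖Finsupp.linearCombination ℂ p c‖ : ℝ) : ℂ) ^ 2 + ((‖eq c‖ : ℝ) : ℂ) ^ 2 =
        (k : ℂ) ^ 2 * ((‖eu c‖ : ℝ) : ℂ) ^ 2 := h1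
      exact_mod_cast h3
    nlinarith [sq_nonneg ‖Finsupp.linearCombination ℂ p c‖]
  have hle : ∀ c : ℝ →₀ ℂ, ‖eq c‖ ≤ k * ‖eu c‖ := by
    intro c
    refine (sq_le_sq₀ (norm_nonneg _) (by positivity)).1 ?_
    rw [mul_pow]; exact hsq c
  set V := (LinearMap.range eu).topologicalClosure with hV
  have hmem : ∀ c, eu c ∈ V := fun c =>
    (LinearMap.range eu).le_topologicalClosure (LinearMap.mem_range_self eu c)
  set e : (ℝ →₀ ℂ) →ₗ[ℂ] V := eu.codRestrict V hmem with he
  have hdense : DenseRange e := by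
    rw [DenseRange, Subtype.dense_iff]
    intro x hx
    rw [← Set.range_comp]
    exact hx
  have hle' : ∀ c, ‖eq c‖ ≤ k * ‖e c‖ := hle
  refine ⟨(eq.extendOfNorm e).comp (V.orthogonalProjectionOnto), ?_, fun t => ?_⟩
  · refine ContinuousLinearMap.opNorm_le_bound _ hk fun x => ?_
    refine (LinearMap.norm_extendOfNorm_apply_le hdense k hle' _).trans ?_
    gcongr
    exact V.norm_orthogonalProjectionOnto_apply_le x
  · have h1 : (e (Finsupp.single t 1) : H) = u t := by
      simp [he, heu]
    rw [ContinuousLinearMap.comp_apply, ← h1,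
      Submodule.orthogonalProjectionOnto_mem_subspace_eq_self,
      LinearMap.extendOfNorm_eq hdense ⟨k, hle'⟩]
    simp [heq]

/-- The conclusion in Hilbert space: with `B` the operator of `exists_clm_of_gram`, the `n`-th
derivative of `⟪v, u h⟫` is `⟪(-B*)ⁿ v, u h⟫`. -/
theorem inner_eq_zero_of_gram {u p q : ℝ → H} {k M : ℝ} (hk : 0 ≤ k)
    (hG : ∀ s t, inner ℂ (p s) (p t) + inner ℂ (q s) (q t) = (k : ℂ) ^ 2 * inner ℂ (u s) (u t))
    (hu : ∀ v h, HasDerivAt (fun h => inner ℂ v (u h)) (-inner ℂ v (q h)) h)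
    (hM : ∀ h, ‖u h‖ ≤ M) {v : H} {h₀ : ℝ} (hv : ∀ h, h₀ < h → inner ℂ v (u h) = 0) (h : ℝ) :
    inner ℂ v (u h) = 0 := by
  obtain ⟨B, hBk, hB⟩ := exists_clm_of_gram hk hG
  set A : H →L[ℂ] H := ContinuousLinearMap.adjoint B with hA
  have hAk : ‖A‖ ≤ k := by rw [hA, LinearIsometryEquiv.norm_map]; exact hBk
  let z : ℕ → H := fun n => (-A)^[n] v
  have hM0 : 0 ≤ M := (norm_nonneg _).trans (hM 0)
  have hz : ∀ n, ‖z n‖ ≤ ‖v‖ * k ^ n := by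
    intro n
    induction n with
    | zero => simp [z]
    | succ n ih =>
      simp only [z, Function.iterate_succ_apply']
      calc ‖(-A) (z n)‖ ≤ ‖-A‖ * ‖z n‖ := ContinuousLinearMap.le_opNorm _ _
        _ ≤ k * (‖v‖ * k ^ n) := by rw [norm_neg]; gcongr
        _ = _ := by ring
  refine eq_zero_of_deriv_bounds (F := fun n h => inner ℂ (z n) (u h)) (C := ‖v‖ * M) hk
    (by positivity) (fun n t => ?_) (fun n t => ?_) (h₀ := h₀) hv h
  · convert hu (z n) t using 1
    simp only [z, Function.iterate_succ_apply', neg_apply, inner_neg_left,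
      hA, ContinuousLinearMap.adjoint_inner_left, hB]
  · calc _ ≤ ‖z n‖ * ‖u t‖ := norm_inner_le_norm _ _
      _ ≤ ‖v‖ * k ^ n * M := by gcongr; exacts [hz n, hM t]
      _ = _ := by ring

end Hilbert

/-! ### Geometry of the region and test functions -/

theorem measurableSet_region {f : ℝ → ℝ} (hf : Continuous f) : MeasurableSet (region f) :=
  measurableSet_le (hf.measurable.comp measurable_fst) measurable_snd

theorem mem_interior_region_of_sub_mem {f : ℝ → ℝ} {p : ℝ × ℝ} {h : ℝ} (hh : 0 ≤ h)
    (hp : p - (0, h) ∈ interior (region f)) : p ∈ interior (region f) := by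
  have h1 : IsOpen ((fun q : ℝ × ℝ => q - (0, h)) ⁻¹' interior (region f)) :=
    isOpen_interior.preimage (by fun_prop)
  refine interior_maximal ?_ h1 hp
  intro q hq
  have := interior_subset hq
  simp only [region, Set.mem_ofPred_eq, Prod.fst_sub, Prod.snd_sub, sub_zero] at this ⊢
  linarith

theorem IsTestFunction.eq_zero {U : Set (ℝ × ℝ)} {φ : ℝ × ℝ → ℂ} (hφ : IsTestFunction U φ)
    {p : ℝ × ℝ} (hp : p ∉ U) : φ p = 0 :=
  image_eq_zero_of_notMem_tsupport fun h => hp (hφ.support h)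

theorem IsTestFunction.fderiv_eq_zero {U : Set (ℝ × ℝ)} {φ : ℝ × ℝ → ℂ}
    (hφ : IsTestFunction U φ) {p : ℝ × ℝ} (hp : p ∉ U) : fderiv ℝ φ p = 0 :=
  image_eq_zero_of_notMem_tsupport fun h => hp (hφ.support (tsupport_fderiv_subset ℝ h))

/-- Test functions remain admissible after an upward translation, because the region is mapped into
itself. -/
theorem IsTestFunction.cutoff_mul_conj_shift {f χ η : ℝ → ℝ} (hχ : ContDiff ℝ ∞ χ)
    (hη : ContDiff ℝ ∞ η) {φ : ℝ × ℝ → ℂ} (hφ : IsTestFunction (interior (region f)) φ) {h : ℝ}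
    (hh : 0 ≤ h) :
    IsTestFunction (interior (region f))
      (fun p => ((χ p.1 * η p.2 : ℝ) : ℂ) * conj (φ (p - (0, h)))) := by
  have hsupp : tsupport (fun p => ((χ p.1 * η p.2 : ℝ) : ℂ) * conj (φ (p - (0, h)))) ⊆
      (Homeomorph.subRight ((0, h) : ℝ × ℝ)) ⁻¹' tsupport φ := by
    rw [← tsupport_comp_eq_preimage]
    refine closure_mono fun p hp => ?_
    simp only [Function.mem_support, ne_eq, mul_eq_zero, not_or, map_eq_zero] at hp ⊢
    exact hp.2
  refine ⟨?_, ?_, ?_⟩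
  · have h1 : ContDiff ℝ ∞ fun p : ℝ × ℝ => χ p.1 * η p.2 := by fun_prop
    have h2 : ContDiff ℝ ∞ fun p : ℝ × ℝ => φ (p - (0, h)) := hφ.smooth.comp (by fun_prop)
    exact (Complex.ofRealCLM.contDiff.comp h1).mul (Complex.conjCLE.contDiff.comp h2)
  · refine HasCompactSupport.of_support_subset_isCompact
      (K := (Homeomorph.subRight ((0, h) : ℝ × ℝ)) ⁻¹' tsupport φ)
      ?_ (subset_closure.trans hsupp)
    exact (Homeomorph.subRight _).isCompact_preimage.2 hφ.compact
  · exact fun p hp => mem_interior_region_of_sub_mem hh (hφ.support (hsupp hp))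

section Derivatives
variable {χ η : ℝ → ℝ} {φ : ℝ × ℝ → ℂ}

theorem fderiv_cutoff_mul_conj_shift (hχ : Differentiable ℝ χ) (hη : Differentiable ℝ η)
    (hφ : Differentiable ℝ φ) (h : ℝ) (p v : ℝ × ℝ) :
    fderiv ℝ (fun p => ((χ p.1 * η p.2 : ℝ) : ℂ) * conj (φ (p - (0, h)))) p v =
      ((v.1 * deriv χ p.1 * η p.2 + χ p.1 * (v.2 * deriv η p.2) : ℝ) : ℂ) *
        conj (φ (p - (0, h))) +
        ((χ p.1 * η p.2 : ℝ) : ℂ) * conj (fderiv ℝ φ (p - (0, h)) v) := by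
  have h2 : HasLineDerivAt ℝ (fun p : ℝ × ℝ => conj (φ (p - (0, h))))
      (conj (fderiv ℝ φ (p - (0, h)) v)) p v := by
    have h3 := Complex.conjCLE.hasFDerivAt.comp_hasDerivAt (0 : ℝ)
      ((hφ (p - (0, h))).hasFDerivAt.hasLineDerivAt v)
    refine h3.congr_of_eventuallyEq (Eventually.of_forall fun t => ?_)
    simp [sub_add_eq_add_sub]
  have h1 : HasLineDerivAt ℝ (fun p : ℝ × ℝ => ((χ p.1 * η p.2 : ℝ) : ℂ))
      ((v.1 * deriv χ p.1 * η p.2 + χ p.1 * (v.2 * deriv η p.2) : ℝ) : ℂ) p v := by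
    have hline : ∀ a b : ℝ, HasDerivAt (fun t : ℝ => a + t * b) b 0 := fun a b => by
      simpa using ((hasDerivAt_id (0 : ℝ)).mul_const b).const_add a
    have h4 : HasDerivAt (fun t : ℝ => χ (p.1 + t * v.1) * η (p.2 + t * v.2))
        (v.1 * deriv χ p.1 * η p.2 + χ p.1 * (v.2 * deriv η p.2)) 0 := by
      have h5 := ((hχ (p.1 + 0 * v.1)).hasDerivAt.comp 0 (hline p.1 v.1)).mul
        ((hη (p.2 + 0 * v.2)).hasDerivAt.comp 0 (hline p.2 v.2))
      refine HasDerivAt.congr_deriv h5 ?_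
      simp [mul_comm]
    refine h4.ofReal_comp.congr_of_eventuallyEq (Eventually.of_forall fun t => ?_)
    simp
  have hd : DifferentiableAt ℝ
      (fun p : ℝ × ℝ => ((χ p.1 * η p.2 : ℝ) : ℂ) * conj (φ (p - (0, h)))) p := by
    have h3 : Differentiable ℝ fun p : ℝ × ℝ => χ p.1 * η p.2 := by fun_prop
    have h4 : Differentiable ℝ fun p : ℝ × ℝ => φ (p - (0, h)) := hφ.comp (by fun_prop)
    exact ((Complex.ofRealCLM.differentiable.comp h3) p).mul
      ((Complex.conjCLE.differentiable.comp h4) p)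
  rw [(hd.hasFDerivAt.hasLineDerivAt v).unique (HasDerivAt.mul h1 h2)]
  simp

end Derivatives

/-! ### Pairings in `L²(ℝ²)` -/

section L2

theorem memLp_shift {F : ℝ × ℝ → ℂ} (hF : MemLp F 2) (v : ℝ × ℝ) :
    MemLp (fun p => F (p - v)) 2 :=
  hF.comp_measurePreserving (measurePreserving_sub_right volume v)

theorem eLpNorm_shift {F : ℝ × ℝ → ℂ} (hF : MemLp F 2) (v : ℝ × ℝ) :
    eLpNorm (fun p => F (p - v)) 2 = eLpNorm F 2 :=
  eLpNorm_comp_measurePreserving hF.1 (measurePreserving_sub_right volume v)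

theorem inner_toLp {F G : ℝ × ℝ → ℂ} (hF : MemLp F 2) (hG : MemLp G 2) :
    inner ℂ (hF.toLp F) (hG.toLp G) = ∫ p, G p * conj (F p) := by
  rw [L2.inner_def]
  refine integral_congr_ae ?_
  filter_upwards [hF.coeFn_toLp, hG.coeFn_toLp] with p h1 h2
  rw [h1, h2, RCLike.inner_apply]

theorem integrable_mul_conj {F G : ℝ × ℝ → ℂ} (hG : MemLp G 2) (hF : MemLp F 2) :
    Integrable fun p => G p * conj (F p) :=
  hG.integrable_mul hF.star

theorem norm_integral_mul_conj_le {F G : ℝ × ℝ → ℂ} (hG : MemLp G 2) (hF : MemLp F 2) :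
    ‖∫ p, G p * conj (F p)‖ ≤ (eLpNorm G 2).toReal * (eLpNorm F 2).toReal := by
  rw [← inner_toLp hF hG, ← Lp.norm_toLp F hF, ← Lp.norm_toLp G hG, mul_comm]
  exact norm_inner_le_norm _ _

theorem tendsto_integral_mul_conj_shift {A : ℝ × ℝ → ℂ} (hA : MemLp A 2)
    {D : ℕ → ℝ × ℝ → ℂ} (hD : ∀ n, MemLp (D n) 2)
    (hlim : Tendsto (fun n => eLpNorm (D n) 2) atTop (𝓝 0)) (v : ℝ × ℝ) :
    Tendsto (fun n => ∫ p, A p * conj (D n (p - v))) atTop (𝓝 0) := by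
  rw [tendsto_zero_iff_norm_tendsto_zero]
  have h1 : Tendsto (fun n => (eLpNorm A 2).toReal * (eLpNorm (D n) 2).toReal) atTop (𝓝 0) := by
    have := ((ENNReal.tendsto_toReal ENNReal.zero_ne_top).comp hlim).const_mul (eLpNorm A 2).toReal
    simpa using this
  refine squeeze_zero (fun _ => norm_nonneg _) (fun n => ?_) h1
  rw [← eLpNorm_shift (hD n) v]
  exact norm_integral_mul_conj_le hA (memLp_shift (hD n) v)

theorem integral_mul_conj_self {F : ℝ × ℝ → ℂ} (hF : MemLp F 2) :
    ∫ p, F p * conj (F p) = ((eLpNorm F 2).toReal : ℂ) ^ 2 := by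
  rw [← inner_toLp hF hF, ← Lp.norm_toLp F hF]
  exact inner_self_eq_norm_sq_to_K _

theorem memLp_height_mul {F : ℝ × ℝ → ℂ} (hF : MemLp F 2) {c : ℝ → ℝ} (hc : Continuous c) {C : ℝ}
    (hC : ∀ y, |c y| ≤ C) : MemLp (fun p : ℝ × ℝ => ((c p.2 : ℝ) : ℂ) * F p) 2 := by
  refine hF.of_le_mul (c := C) ((Complex.continuous_ofReal.comp
    (hc.comp continuous_snd)).aestronglyMeasurable.mul hF.1) (Eventually.of_forall fun p => ?_)
  rw [norm_mul, Complex.norm_real]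
  gcongr
  exact hC p.2

end L2

/-! ### The equation tested with translates of the solution -/

/-- The extension of `u` from the region to the plane by zero. -/
noncomputable def zeroExt (f : ℝ → ℝ) (u : ℝ × ℝ → ℂ) : ℝ × ℝ → ℂ := (region f).indicator u

theorem locallyL2_of_continuous {f : ℝ → ℝ} {g : ℝ × ℝ → ℂ} (hg : Continuous g) :
    LocallyL2 f g := by
  intro K hK
  obtain ⟨B, hB⟩ := hK.exists_bound_of_continuousOn hg.continuousOn
  have : IsFiniteMeasure (volume.restrict K) := ⟨by simpa using hK.measure_lt_top⟩
  exact (MemLp.of_bound hg.aestronglyMeasurable B ((ae_restrict_iff' hK.measurableSet).2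
    (Eventually.of_forall hB))).mono_measure (Measure.restrict_mono Set.inter_subset_right le_rfl)

theorem memLp_cutoff_mul_zeroExt {f : ℝ → ℝ} (hf : Continuous f) {m : ℝ} (hm : ∀ x, m ≤ f x)
    {u : ℝ × ℝ → ℂ} (hu : LocallyL2 f u) {c : ℝ × ℝ → ℝ} (hc : Continuous c) {a b R : ℝ}
    (hcs : ∀ p, c p ≠ 0 → p.1 ∈ Set.Icc a b ∧ p.2 ≤ R) :
    MemLp (fun p => (c p : ℂ) * zeroExt f u p) 2 := by
  set Q : Set (ℝ × ℝ) := Set.Icc a b ×ˢ Set.Icc m R with hQ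
  have hQc : IsCompact Q := isCompact_Icc.prod isCompact_Icc
  have hQm : MeasurableSet (region f ∩ Q) := (measurableSet_region hf).inter hQc.measurableSet
  obtain ⟨C, hC⟩ := hQc.exists_bound_of_continuousOn hc.continuousOn
  have h1 : MemLp ((region f ∩ Q).indicator u) 2 := (memLp_indicator_iff_restrict hQm).2 (hu Q hQc)
  have heq : (fun p => (c p : ℂ) * zeroExt f u p) =
      fun p => (c p : ℂ) * (region f ∩ Q).indicator u p := by
    funext p
    by_cases hp : p ∈ region f
    · by_cases hcp : c p = 0
      · simp [hcp]
      · have hpQ : p ∈ Q := ⟨(hcs p hcp).1, (hm _).trans hp, (hcs p hcp).2⟩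
        simp [zeroExt, hp, hpQ]
    · simp [zeroExt, hp]
  rw [heq]
  refine h1.of_le_mul (c := C) ?_ (Eventually.of_forall fun p => ?_)
  · exact (Complex.continuous_ofReal.comp hc).aestronglyMeasurable.mul h1.1
  · by_cases hp : p ∈ region f ∩ Q
    · rw [norm_mul, Complex.norm_real]
      gcongr
      exact hC p hp.2
    · simp [Set.indicator_of_notMem hp]

/-- If `ψ n` tends to `u` in `L²` of a bounded piece of the region, the translates of `ψ n` by an
upward shift may be replaced by those of `u` in a pairing with a function that lives below height
`R`: the shift being upward, only values of `ψ n` below that height enter. -/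
theorem tendsto_integral_mul_conj_approx {f : ℝ → ℝ} (hf : Continuous f) {m : ℝ}
    (hm : ∀ x, m ≤ f x) {u : ℝ × ℝ → ℂ} (hu : LocallyL2 f u) {A : ℝ × ℝ → ℂ} (hA : MemLp A 2)
    {a b R : ℝ} (hAs : ∀ p, A p ≠ 0 → p.1 ∈ Set.Icc a b ∧ p.2 ≤ R) {h : ℝ} (hh : 0 ≤ h)
    {ψ : ℕ → ℝ × ℝ → ℂ} (hψ : ∀ n, Continuous (ψ n)) (hψ0 : ∀ n p, p ∉ region f → ψ n p = 0)
    (hlim : Tendsto (fun n => eLpNorm (fun p => u p - ψ n p) 2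
      (volume.restrict (region f ∩ Set.Icc a b ×ˢ Set.Icc m R))) atTop (𝓝 0)) :
    Tendsto (fun n => ∫ p, A p * conj (ψ n (p - (0, h)))) atTop
      (𝓝 (∫ p, A p * conj (zeroExt f u (p - (0, h))))) := by
  set Q : Set (ℝ × ℝ) := Set.Icc a b ×ˢ Set.Icc m R with hQ
  have hQc : IsCompact Q := isCompact_Icc.prod isCompact_Icc
  have hQm : MeasurableSet (region f ∩ Q) := (measurableSet_region hf).inter hQc.measurableSet
  have huQ : MemLp ((region f ∩ Q).indicator u) 2 := (memLp_indicator_iff_restrict hQm).2 (hu Q hQc)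
  have hψQ : ∀ n, MemLp ((region f ∩ Q).indicator (ψ n)) 2 := fun n => by
    rw [memLp_indicator_iff_restrict hQm]
    exact locallyL2_of_continuous (hψ n) Q hQc
  have hD : ∀ n, MemLp ((region f ∩ Q).indicator fun p => u p - ψ n p) 2 := fun n => by
    rw [show (fun p => u p - ψ n p) = u - ψ n from rfl, Set.indicator_sub']
    exact huQ.sub (hψQ n)
  have hlim' : Tendsto (fun n => eLpNorm ((region f ∩ Q).indicator fun p => u p - ψ n p) 2)
      atTop (𝓝 0) := by
    simpa only [eLpNorm_indicator_eq_eLpNorm_restrict hQm] using hlim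
  -- on the support of `A`, the translated point lies in `Q` as soon as it lies in the region
  have hloc : ∀ (g : ℝ × ℝ → ℂ), (∀ p, p ∉ region f → g p = 0) → ∀ p,
      A p * conj (g (p - (0, h))) = A p * conj ((region f ∩ Q).indicator g (p - (0, h))) := by
    intro g hg p
    by_cases hAp : A p = 0
    · simp [hAp]
    by_cases hp : p - (0, h) ∈ region f
    · have hpQ : p - (0, h) ∈ Q := by
        obtain ⟨h1, h2⟩ := hAs p hAp
        refine ⟨by simpa using h1, (hm _).trans hp, ?_⟩
        simp only [Prod.snd_sub]; linarith
      rw [Set.indicator_of_mem (show p - (0, h) ∈ region f ∩ Q from ⟨hp, hpQ⟩)]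
    · rw [Set.indicator_of_notMem (fun hmem => hp hmem.1), hg _ hp]
  have h1 : ∀ n, ∫ p, A p * conj (ψ n (p - (0, h))) =
      (∫ p, A p * conj (zeroExt f u (p - (0, h)))) -
        ∫ p, A p * conj ((region f ∩ Q).indicator (fun p => u p - ψ n p) (p - (0, h))) := by
    intro n
    have e1 : ∀ p, A p * conj (zeroExt f u (p - (0, h))) =
        A p * conj ((region f ∩ Q).indicator u (p - (0, h))) := by
      intro p
      rw [hloc (zeroExt f u) (fun p hp => Set.indicator_of_notMem hp u), zeroExt,
        Set.indicator_indicator, Set.inter_right_comm, Set.inter_self]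
    simp_rw [hloc (ψ n) (hψ0 n), e1]
    rw [← integral_sub (integrable_mul_conj hA (memLp_shift huQ _))
      (integrable_mul_conj hA (memLp_shift (hD n) _))]
    refine integral_congr_ae (Eventually.of_forall fun p => ?_)
    simp only [Set.indicator]
    split_ifs <;> simp; ring
  simp_rw [h1]
  simpa using (tendsto_integral_mul_conj_shift hA hD hlim' (0, h)).const_sub
    (∫ p, A p * conj (zeroExt f u (p - (0, h))))

section Tested
variable {f : ℝ → ℝ} {k : ℝ} {w wx wy : ℝ × ℝ → ℂ}

theorem setIntegral_region_mul (hf : Continuous f) (u g : ℝ × ℝ → ℂ) :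
    ∫ p in region f, u p * g p = ∫ p, zeroExt f u p * g p := by
  rw [← integral_indicator (measurableSet_region hf)]
  refine integral_congr_ae (Eventually.of_forall fun p => ?_)
  by_cases hp : p ∈ region f <;> simp [zeroExt, hp]

theorem exists_testFunction_seq (hbc : VanishesOnBoundary f w wx wy) {K : Set (ℝ × ℝ)}
    (hK : IsCompact K) :
    ∃ φ : ℕ → ℝ × ℝ → ℂ, (∀ n, IsTestFunction (interior (region f)) (φ n)) ∧
      Tendsto (fun n => eLpNorm (fun p => w p - φ n p) 2 (volume.restrict (region f ∩ K)))
        atTop (𝓝 0) ∧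
      Tendsto (fun n => eLpNorm (fun p => wx p - dx (φ n) p) 2 (volume.restrict (region f ∩ K)))
        atTop (𝓝 0) ∧
      Tendsto (fun n => eLpNorm (fun p => wy p - dy (φ n) p) 2 (volume.restrict (region f ∩ K)))
        atTop (𝓝 0) := by
  have hpos : ∀ n : ℕ, (0 : ℝ≥0∞) < (n : ℝ≥0∞)⁻¹ := fun n => by simp
  choose φ hφ h0 hx hy using fun n : ℕ => hbc K hK _ (hpos n)
  have hlim : Tendsto (fun n : ℕ => (n : ℝ≥0∞)⁻¹) atTop (𝓝 0) :=
    ENNReal.tendsto_inv_nat_nhds_zero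
  exact ⟨φ, hφ, tendsto_of_tendsto_of_tendsto_of_le_of_le tendsto_const_nhds hlim (fun _ => zero_le)
    h0, tendsto_of_tendsto_of_tendsto_of_le_of_le tendsto_const_nhds hlim (fun _ => zero_le) hx,
    tendsto_of_tendsto_of_tendsto_of_le_of_le tendsto_const_nhds hlim (fun _ => zero_le) hy⟩

/-- The Helmholtz equation tested with the product of `χ(x) η(y)` and the conjugate of the upward
translate of the solution. The cutoff `η` need only vanish high up: no cutoff is needed near the
boundary, since the solution is a limit of functions supported inside the region. -/
theorem tested_identity (hf : Continuous f) {m : ℝ} (hm : ∀ x, m ≤ f x)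
    (hgrad : HasWeakGradient f w wx wy) (heq : SolvesHelmholtz f k w wx wy)
    (hbc : VanishesOnBoundary f w wx wy) {χ η : ℝ → ℝ} (hχ : ContDiff ℝ ∞ χ)
    (hη : ContDiff ℝ ∞ η) {a b R : ℝ} (hχs : tsupport χ ⊆ Set.Icc a b)
    (hηs : tsupport η ⊆ Set.Iic R) {h : ℝ} (hh : 0 ≤ h) :
    (∫ p : ℝ × ℝ, (((deriv χ p.1 * η p.2 : ℝ) : ℂ) * zeroExt f wx p) *
        conj (zeroExt f w (p - (0, h)))) +
      (∫ p : ℝ × ℝ, (((χ p.1 * deriv η p.2 : ℝ) : ℂ) * zeroExt f wy p) *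
        conj (zeroExt f w (p - (0, h)))) +
      (∫ p : ℝ × ℝ, (((χ p.1 * η p.2 : ℝ) : ℂ) * zeroExt f wx p) *
        conj (zeroExt f wx (p - (0, h)))) +
      (∫ p : ℝ × ℝ, (((χ p.1 * η p.2 : ℝ) : ℂ) * zeroExt f wy p) *
        conj (zeroExt f wy (p - (0, h)))) =
      (k : ℂ) ^ 2 * ∫ p : ℝ × ℝ, (((χ p.1 * η p.2 : ℝ) : ℂ) * zeroExt f w p) *
        conj (zeroExt f w (p - (0, h))) := by
  have hχ0 : ∀ x, χ x ≠ 0 → x ∈ Set.Icc a b := fun x hx => hχs (subset_tsupport _ hx)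
  have hη0 : ∀ y, η y ≠ 0 → y ≤ R := fun y hy => hηs (subset_tsupport _ hy)
  have hχ1 : ∀ x, deriv χ x ≠ 0 → x ∈ Set.Icc a b := fun x hx => hχs (support_deriv_subset hx)
  have hη1 : ∀ y, deriv η y ≠ 0 → y ≤ R := fun y hy => hηs (support_deriv_subset hy)
  have cχ := hχ.continuous
  have cη := hη.continuous
  have cχ' : Continuous (deriv χ) := hχ.continuous_deriv (by simp)
  have cη' : Continuous (deriv η) := hη.continuous_deriv (by simp)
  have s00 : ∀ p : ℝ × ℝ, χ p.1 * η p.2 ≠ 0 → p.1 ∈ Set.Icc a b ∧ p.2 ≤ R := fun p hp =>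
    ⟨hχ0 _ (left_ne_zero_of_mul hp), hη0 _ (right_ne_zero_of_mul hp)⟩
  have s10 : ∀ p : ℝ × ℝ, deriv χ p.1 * η p.2 ≠ 0 → p.1 ∈ Set.Icc a b ∧ p.2 ≤ R := fun p hp =>
    ⟨hχ1 _ (left_ne_zero_of_mul hp), hη0 _ (right_ne_zero_of_mul hp)⟩
  have s01 : ∀ p : ℝ × ℝ, χ p.1 * deriv η p.2 ≠ 0 → p.1 ∈ Set.Icc a b ∧ p.2 ≤ R := fun p hp =>
    ⟨hχ0 _ (left_ne_zero_of_mul hp), hη1 _ (right_ne_zero_of_mul hp)⟩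
  obtain ⟨φ, hφ, l0, lx, ly⟩ := exists_testFunction_seq hbc (K := Set.Icc a b ×ˢ Set.Icc m R)
    (isCompact_Icc.prod isCompact_Icc)
  have hout : ∀ p, p ∉ region f → p ∉ interior (region f) := fun p hp h => hp (interior_subset h)
  have mem : ∀ {c : ℝ × ℝ → ℝ} {u : ℝ × ℝ → ℂ}, Continuous c →
      (∀ p, c p ≠ 0 → p.1 ∈ Set.Icc a b ∧ p.2 ≤ R) → LocallyL2 f u →
      MemLp (fun p => (c p : ℂ) * zeroExt f u p) 2 := fun hc hs hu =>
    memLp_cutoff_mul_zeroExt hf hm hu hc hs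
  have supp : ∀ {c : ℝ × ℝ → ℝ} {u : ℝ × ℝ → ℂ},
      (∀ p, c p ≠ 0 → p.1 ∈ Set.Icc a b ∧ p.2 ≤ R) → ∀ p, (c p : ℂ) * zeroExt f u p ≠ 0 →
      p.1 ∈ Set.Icc a b ∧ p.2 ≤ R := fun hs p hp =>
    hs p (by simpa using left_ne_zero_of_mul hp)
  have lim : ∀ {c : ℝ × ℝ → ℝ} {u g : ℝ × ℝ → ℂ} {ψ : ℕ → ℝ × ℝ → ℂ}, Continuous c →
      (∀ p, c p ≠ 0 → p.1 ∈ Set.Icc a b ∧ p.2 ≤ R) → LocallyL2 f u → LocallyL2 f g →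
      (∀ n, Continuous (ψ n)) → (∀ n p, p ∉ region f → ψ n p = 0) →
      Tendsto (fun n => eLpNorm (fun p => g p - ψ n p) 2
        (volume.restrict (region f ∩ Set.Icc a b ×ˢ Set.Icc m R))) atTop (𝓝 0) →
      Tendsto (fun n => ∫ p, ((c p : ℂ) * zeroExt f u p) * conj (ψ n (p - (0, h)))) atTop
        (𝓝 (∫ p, ((c p : ℂ) * zeroExt f u p) * conj (zeroExt f g (p - (0, h))))) :=
    fun hc hs hu hg hψ hψ0 hlim =>
      tendsto_integral_mul_conj_approx hf hm hg (mem hc hs hu) (supp hs) hh hψ hψ0 hlim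
  have cφ : ∀ n, Continuous (φ n) := fun n => (hφ n).smooth.continuous
  have cφ' : ∀ n, Continuous (fderiv ℝ (φ n)) := fun n => (hφ n).smooth.continuous_fderiv (by simp)
  have cdx : ∀ n, Continuous (dx (φ n)) := fun n => (cφ' n).clm_apply continuous_const
  have cdy : ∀ n, Continuous (dy (φ n)) := fun n => (cφ' n).clm_apply continuous_const
  have z0 : ∀ n p, p ∉ region f → φ n p = 0 := fun n p hp => (hφ n).eq_zero (hout p hp)
  have zx : ∀ n p, p ∉ region f → dx (φ n) p = 0 := fun n p hp => by
    rw [dx, (hφ n).fderiv_eq_zero (hout p hp)]; rfl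
  have zy : ∀ n p, p ∉ region f → dy (φ n) p = 0 := fun n p hp => by
    rw [dy, (hφ n).fderiv_eq_zero (hout p hp)]; rfl
  have c00 : Continuous fun p : ℝ × ℝ => χ p.1 * η p.2 := by fun_prop
  have c10 : Continuous fun p : ℝ × ℝ => deriv χ p.1 * η p.2 := by fun_prop
  have c01 : Continuous fun p : ℝ × ℝ => χ p.1 * deriv η p.2 := by fun_prop
  have T1 := lim c10 s10 hgrad.memL2_x hgrad.memL2 cφ z0 l0
  have T2 := lim c01 s01 hgrad.memL2_y hgrad.memL2 cφ z0 l0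
  have T3 := lim c00 s00 hgrad.memL2_x hgrad.memL2_x cdx zx lx
  have T4 := lim c00 s00 hgrad.memL2_y hgrad.memL2_y cdy zy ly
  have T5 := (lim c00 s00 hgrad.memL2 hgrad.memL2 cφ z0 l0).const_mul ((k : ℂ) ^ 2)
  refine tendsto_nhds_unique (((T1.add T2).add T3).add T4) (T5.congr fun n => ?_)
  have hmem : ∀ {ψ : ℝ × ℝ → ℂ}, Continuous ψ → HasCompactSupport ψ → MemLp ψ 2 := fun h1 h2 =>
    h1.memLp_of_hasCompactSupport h2
  have m0 := memLp_shift (hmem (cφ n) (hφ n).compact) (0, h)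
  have mx := memLp_shift (hmem (cdx n) ((hφ n).compact.fderiv_apply (𝕜 := ℝ) (1, 0))) (0, h)
  have my := memLp_shift (hmem (cdy n) ((hφ n).compact.fderiv_apply (𝕜 := ℝ) (0, 1))) (0, h)
  have key := heq _ ((hφ n).cutoff_mul_conj_shift hχ hη hh)
  have i1 := integrable_mul_conj (mem c10 s10 hgrad.memL2_x) m0
  have i2 := integrable_mul_conj (mem c01 s01 hgrad.memL2_y) m0
  have i3 := integrable_mul_conj (mem c00 s00 hgrad.memL2_x) mx
  have i4 := integrable_mul_conj (mem c00 s00 hgrad.memL2_y) my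
  rw [← integral_add' i1 i2, ← integral_add' (i1.add i2) i3,
    ← integral_add' ((i1.add i2).add i3) i4]
  rw [setIntegral_region_mul hf] at key
  have key2 : (k : ℂ) ^ 2 * (∫ p : ℝ × ℝ, (((χ p.1 * η p.2 : ℝ) : ℂ) * zeroExt f w p) *
      conj (φ n (p - (0, h)))) = (k : ℂ) ^ 2 * ∫ p : ℝ × ℝ, zeroExt f w p *
        (((χ p.1 * η p.2 : ℝ) : ℂ) * conj (φ n (p - (0, h)))) := by
    congr 2
    funext p
    ring
  rw [key2, ← key, ← integral_indicator (measurableSet_region hf)]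
  refine integral_congr_ae (Eventually.of_forall fun p => ?_)
  have hχd : Differentiable ℝ χ := hχ.differentiable (by simp)
  have hηd : Differentiable ℝ η := hη.differentiable (by simp)
  have hφd : Differentiable ℝ (φ n) := (hφ n).smooth.differentiable (by simp)
  by_cases hp : p ∈ region f
  · simp only [Set.indicator_of_mem hp, zeroExt, dx, dy, Pi.add_apply,
      fderiv_cutoff_mul_conj_shift hχd hηd hφd]
    simp only [one_mul, zero_mul, mul_zero, add_zero, zero_add]
    ring
  · simp [zeroExt, hp]

end Tested

/-! ### Cutoff functions -/

/-- A smooth nondecreasing step from `0` (for `x ≤ 0`) to `1` (for `x ≥ L`). -/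
noncomputable def unitStep (L x : ℝ) : ℝ := Real.smoothTransition (x / L)

/-- A smooth bump on `[0, 2L]` whose translates by the multiples of `L` sum to one, being the
difference of a step and its translate by `L`. -/
noncomputable def periodCutoff (L x : ℝ) : ℝ := unitStep L x - unitStep L (x - L)

/-- A smooth cutoff in the height, equal to `1` for `y ≤ R` and to `0` for `y ≥ R + 1`. -/
noncomputable def heightCutoff (R y : ℝ) : ℝ := 1 - Real.smoothTransition (y - R)

theorem contDiff_unitStep (L : ℝ) : ContDiff ℝ ∞ (unitStep L) :=
  (Real.smoothTransition.contDiff (n := ⊤)).comp (contDiff_id.div_const L)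

theorem contDiff_periodCutoff (L : ℝ) : ContDiff ℝ ∞ (periodCutoff L) :=
  (contDiff_unitStep L).sub ((contDiff_unitStep L).comp (contDiff_id.sub contDiff_const))

theorem contDiff_heightCutoff (R : ℝ) : ContDiff ℝ ∞ (heightCutoff R) :=
  contDiff_const.sub ((Real.smoothTransition.contDiff (n := ⊤)).comp
    (contDiff_id.sub contDiff_const))

section PeriodCutoff
variable {L : ℝ}

theorem periodCutoff_of_nonpos (hL : 0 < L) {x : ℝ} (hx : x ≤ 0) : periodCutoff L x = 0 := by
  rw [periodCutoff, unitStep, unitStep, Real.smoothTransition.zero_of_nonpos,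
    Real.smoothTransition.zero_of_nonpos, sub_zero]
  · exact div_nonpos_of_nonpos_of_nonneg (by linarith) hL.le
  · exact div_nonpos_of_nonpos_of_nonneg hx hL.le

theorem periodCutoff_of_le (hL : 0 < L) {x : ℝ} (hx : x ≤ L) : periodCutoff L x = unitStep L x := by
  have h : unitStep L (x - L) = 0 := Real.smoothTransition.zero_of_nonpos
    (div_nonpos_of_nonpos_of_nonneg (by linarith) hL.le)
  rw [periodCutoff, h, sub_zero]

theorem periodCutoff_of_ge (hL : 0 < L) {x : ℝ} (hx : L ≤ x) :
    periodCutoff L x = 1 - unitStep L (x - L) := by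
  rw [periodCutoff, unitStep, Real.smoothTransition.one_of_one_le]
  rwa [le_div_iff₀ hL, one_mul]

theorem periodCutoff_of_two_mul_le (hL : 0 < L) {x : ℝ} (hx : 2 * L ≤ x) :
    periodCutoff L x = 0 := by
  rw [periodCutoff_of_ge hL (by linarith), unitStep, Real.smoothTransition.one_of_one_le, sub_self]
  rw [le_div_iff₀ hL]; linarith

theorem periodCutoff_nonneg (hL : 0 < L) (x : ℝ) : 0 ≤ periodCutoff L x := by
  rcases le_total x L with hx | hx
  · rw [periodCutoff_of_le hL hx]; exact Real.smoothTransition.nonneg _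
  · rw [periodCutoff_of_ge hL hx]; exact sub_nonneg.2 (Real.smoothTransition.le_one _)

theorem periodCutoff_le_one (x : ℝ) : periodCutoff L x ≤ 1 :=
  (sub_le_self _ (Real.smoothTransition.nonneg _)).trans (Real.smoothTransition.le_one _)

theorem periodCutoff_pos (hL : 0 < L) {x : ℝ} (hx : 0 < x) (hx' : x ≤ L) :
    0 < periodCutoff L x := by
  rw [periodCutoff_of_le hL hx']; exact Real.smoothTransition.pos_of_pos (div_pos hx hL)

theorem tsupport_periodCutoff (hL : 0 < L) : tsupport (periodCutoff L) ⊆ Set.Icc 0 (2 * L) := by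
  refine closure_minimal (fun x hx => ?_) isClosed_Icc
  by_contra h
  rw [Set.mem_Icc, not_and_or, not_le, not_le] at h
  rcases h with h | h
  · exact hx (periodCutoff_of_nonpos hL h.le)
  · exact hx (periodCutoff_of_two_mul_le hL h.le)

theorem deriv_periodCutoff (x : ℝ) :
    deriv (periodCutoff L) x = deriv (unitStep L) x - deriv (unitStep L) (x - L) := by
  have hd : Differentiable ℝ (unitStep L) := (contDiff_unitStep L).differentiable (by simp)
  exact ((hd x).hasDerivAt.sub ((hd (x - L)).hasDerivAt.comp_sub_const x L)).deriv

theorem deriv_unitStep_support (hL : 0 < L) {x : ℝ} (hx : deriv (unitStep L) x ≠ 0) :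
    x ∈ Set.Icc 0 L := by
  by_contra h
  rw [Set.mem_Icc, not_and_or, not_le, not_le] at h
  refine hx ?_
  rcases h with h | h
  · have h1 : unitStep L =ᶠ[𝓝 x] fun _ => 0 := by
      filter_upwards [Iio_mem_nhds h] with y hy
      exact Real.smoothTransition.zero_of_nonpos (div_nonpos_of_nonpos_of_nonneg hy.le hL.le)
    rw [h1.deriv_eq, deriv_const]
  · have h1 : unitStep L =ᶠ[𝓝 x] fun _ => 1 := by
      filter_upwards [Ioi_mem_nhds h] with y hy
      exact Real.smoothTransition.one_of_one_le ((le_div_iff₀ hL).2 (by simpa using hy.le))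
    rw [h1.deriv_eq, deriv_const]

end PeriodCutoff

section HeightCutoff

theorem heightCutoff_of_le {R y : ℝ} (h : y ≤ R) : heightCutoff R y = 1 := by
  rw [heightCutoff, Real.smoothTransition.zero_of_nonpos (by linarith), sub_zero]

theorem heightCutoff_of_ge {R y : ℝ} (h : R + 1 ≤ y) : heightCutoff R y = 0 := by
  rw [heightCutoff, Real.smoothTransition.one_of_one_le (by linarith), sub_self]

theorem abs_heightCutoff_le (R y : ℝ) : |heightCutoff R y| ≤ 1 := by
  rw [abs_le, heightCutoff]
  constructor <;> linarith [Real.smoothTransition.nonneg (y - R),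
    Real.smoothTransition.le_one (y - R)]

theorem tsupport_heightCutoff (R : ℝ) : tsupport (heightCutoff R) ⊆ Set.Iic (R + 1) := by
  refine closure_minimal (fun y hy => ?_) isClosed_Iic
  by_contra h
  exact hy (heightCutoff_of_ge (not_le.1 h).le)

theorem deriv_heightCutoff (R y : ℝ) :
    deriv (heightCutoff R) y = -deriv Real.smoothTransition (y - R) := by
  have hd : Differentiable ℝ Real.smoothTransition :=
    (Real.smoothTransition.contDiff (n := ⊤)).differentiable (by simp)
  exact (((hd (y - R)).hasDerivAt.comp_sub_const y R).const_sub 1).deriv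

theorem deriv_heightCutoff_of_lt {R y : ℝ} (h : y < R) : deriv (heightCutoff R) y = 0 := by
  have h1 : heightCutoff R =ᶠ[𝓝 y] fun _ => 1 := by
    filter_upwards [Iio_mem_nhds h] with z hz using heightCutoff_of_le (le_of_lt hz)
  rw [h1.deriv_eq, deriv_const]

theorem exists_abs_deriv_heightCutoff_le :
    ∃ C : ℝ, 0 ≤ C ∧ ∀ R y, |deriv (heightCutoff R) y| ≤ C := by
  have hc : Continuous (deriv Real.smoothTransition) :=
    (Real.smoothTransition.contDiff (n := ⊤)).continuous_deriv (by simp)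
  obtain ⟨C, hC⟩ := (isCompact_Icc (a := (0 : ℝ)) (b := 1)).exists_bound_of_continuousOn
    hc.continuousOn
  have hC0 : 0 ≤ C := (norm_nonneg _).trans (hC 0 (by simp))
  refine ⟨C, hC0, fun R y => ?_⟩
  rw [deriv_heightCutoff, abs_neg]
  by_cases h : y - R ∈ Set.Icc (0 : ℝ) 1
  · exact hC _ h
  · have h1 : unitStep 1 = Real.smoothTransition := by funext x; simp [unitStep]
    have h2 : deriv Real.smoothTransition (y - R) = 0 := by
      by_contra h3
      rw [← h1] at h3
      exact h (deriv_unitStep_support one_pos h3)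
    rw [h2, abs_zero]; exact hC0

theorem tendsto_heightCutoff (y : ℝ) :
    Tendsto (fun n : ℕ => heightCutoff n y) atTop (𝓝 1) := by
  refine tendsto_const_nhds.congr' ?_
  filter_upwards [eventually_ge_atTop ⌈y⌉₊] with n hn
  rw [heightCutoff_of_le ((Nat.le_ceil y).trans (by exact_mod_cast hn))]

theorem tendsto_deriv_heightCutoff (y : ℝ) :
    Tendsto (fun n : ℕ => deriv (heightCutoff n) y) atTop (𝓝 0) := by
  refine tendsto_const_nhds.congr' ?_
  filter_upwards [eventually_gt_atTop ⌈y⌉₊] with n hn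
  rw [deriv_heightCutoff_of_lt ((Nat.le_ceil y).trans_lt (by exact_mod_cast hn))]

end HeightCutoff

/-! ### Quasiperiodic functions -/

section Quasi
variable {f : ℝ → ℝ} {L : ℝ} {ν : ℂ} {u : ℝ × ℝ → ℂ}

theorem Quasiperiodic.ae_zeroExt (hf : Continuous f) (hper : Function.Periodic f L)
    (hu : Quasiperiodic f L ν u) :
    ∀ᵐ p : ℝ × ℝ, zeroExt f u (p + (L, 0)) = ν * zeroExt f u p := by
  have h1 := (ae_restrict_iff' (measurableSet_region hf)).1 hu
  filter_upwards [h1] with p hp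
  have hiff : p + (L, 0) ∈ region f ↔ p ∈ region f := by
    simp [region, hper p.1]
  by_cases hpr : p ∈ region f
  · rw [zeroExt, Set.indicator_of_mem (hiff.2 hpr), Set.indicator_of_mem hpr, ← hp hpr]
    simp [Prod.add_def]
  · rw [zeroExt, Set.indicator_of_notMem (fun h => hpr (hiff.1 h)), Set.indicator_of_notMem hpr,
      mul_zero]

/-- The derivative of the period cutoff is the difference of a function and its translate by one
period, so its integral against a periodic function vanishes. -/
theorem integral_deriv_periodCutoff_mul {F : ℝ × ℝ → ℂ}
    (hF : ∀ᵐ p : ℝ × ℝ, F (p + (L, 0)) = F p)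
    (hint : Integrable fun p : ℝ × ℝ => ((deriv (unitStep L) p.1 : ℝ) : ℂ) * F p) :
    ∫ p : ℝ × ℝ, ((deriv (periodCutoff L) p.1 : ℝ) : ℂ) * F p = 0 := by
  set g : ℝ × ℝ → ℂ := fun p => ((deriv (unitStep L) p.1 : ℝ) : ℂ) * F p with hg
  have h1 : (fun p : ℝ × ℝ => ((deriv (unitStep L) (p.1 - L) : ℝ) : ℂ) * F p)
      =ᵐ[volume] fun p => g (p - (L, 0)) := by
    have h2 := (measurePreserving_sub_right (volume : Measure (ℝ × ℝ))
      (L, 0)).quasiMeasurePreserving.ae hF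
    filter_upwards [h2] with p hp
    rw [sub_add_cancel] at hp
    simp [hg, hp]
  have h3 : Integrable (fun p => g (p - (L, 0))) := hint.comp_sub_right (L, 0)
  simp_rw [deriv_periodCutoff, Complex.ofReal_sub, sub_mul]
  rw [integral_sub hint (h3.congr h1.symm), integral_congr_ae h1, integral_sub_right_eq_self g,
    sub_self]

end Quasi

/-- The hypotheses on a solution `w` with weak gradient `(wx, wy)`, for a graph bounded below by `m`
and a multiplier `ν` of modulus one. Nothing is assumed about the periodicity of `wy`. -/
structure IsGratingSolution (f : ℝ → ℝ) (L k m : ℝ) (ν : ℂ) (w wx wy : ℝ × ℝ → ℂ) : Prop where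
  cont : Continuous f
  lower : ∀ x, m ≤ f x
  pos : 0 < L
  periodic : Function.Periodic f L
  unimodular : ν * conj ν = 1
  memLp : MemLp w 2 (volume.restrict (cell f L))
  grad : HasWeakGradient f w wx wy
  helmholtz : SolvesHelmholtz f k w wx wy
  boundary : VanishesOnBoundary f w wx wy
  quasi : Quasiperiodic f L ν w
  quasi_x : Quasiperiodic f L ν wx

/-- The zero extension of `u` times the square root of the period cutoff, so that an `L²(ℝ²)` inner
product of such functions is an integral against the cutoff. The weight depends on `x` only and
therefore commutes with vertical translations. -/
noncomputable def weighted (f : ℝ → ℝ) (L : ℝ) (u : ℝ × ℝ → ℂ) (p : ℝ × ℝ) : ℂ :=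
  ((√(periodCutoff L p.1) : ℝ) : ℂ) * zeroExt f u p

theorem weighted_mul_conj {f : ℝ → ℝ} {L : ℝ} (hL : 0 < L) (u v : ℝ × ℝ → ℂ) (h : ℝ) (p : ℝ × ℝ) :
    weighted f L u p * conj (weighted f L v (p - (0, h))) =
      ((periodCutoff L p.1 : ℝ) : ℂ) * (zeroExt f u p * conj (zeroExt f v (p - (0, h)))) := by
  have h1 : ((√(periodCutoff L p.1) : ℝ) : ℂ) * ((√(periodCutoff L p.1) : ℝ) : ℂ) =
      ((periodCutoff L p.1 : ℝ) : ℂ) := by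
    rw [← Complex.ofReal_mul, Real.mul_self_sqrt (periodCutoff_nonneg hL _)]
  rw [← h1]
  simp only [weighted, map_mul, Complex.conj_ofReal, Prod.fst_sub, sub_zero]
  ring

theorem continuous_sqrt_periodCutoff (L : ℝ) :
    Continuous fun p : ℝ × ℝ => √(periodCutoff L p.1) :=
  Real.continuous_sqrt.comp ((contDiff_periodCutoff L).continuous.comp continuous_fst)

theorem norm_sqrt_periodCutoff_mul_le (L x : ℝ) (z : ℂ) :
    ‖((√(periodCutoff L x) : ℝ) : ℂ) * z‖ ≤ ‖z‖ := by
  rw [norm_mul, Complex.norm_real, Real.norm_of_nonneg (Real.sqrt_nonneg _)]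
  exact mul_le_of_le_one_left (norm_nonneg _) (Real.sqrt_le_one.2 (periodCutoff_le_one _))

/-! ### Height cutoffs of weighted functions -/

theorem tendsto_integral_bounded_mul {G : ℝ × ℝ → ℂ} (hG : Integrable G)
    {c : ℕ → ℝ → ℝ} (hc : ∀ n, Continuous (c n)) {C : ℝ} (hC : ∀ n y, |c n y| ≤ C) {c₀ : ℝ}
    (hlim : ∀ y, Tendsto (fun n => c n y) atTop (𝓝 c₀)) :
    Tendsto (fun n => ∫ p : ℝ × ℝ, ((c n p.2 : ℝ) : ℂ) * G p) atTop (𝓝 (c₀ * ∫ p, G p)) := by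
  rw [← integral_const_mul]
  refine tendsto_integral_of_dominated_convergence (fun p => C * ‖G p‖) (fun n => ?_)
    (hG.norm.const_mul C) (fun n => Eventually.of_forall fun p => ?_)
    (Eventually.of_forall fun p => ?_)
  · exact (Complex.continuous_ofReal.comp
      ((hc n).comp continuous_snd)).aestronglyMeasurable.mul hG.1
  · rw [norm_mul, Complex.norm_real]
    gcongr
    exact hC n p.2
  · exact ((Complex.continuous_ofReal.tendsto c₀).comp (hlim p.2)).mul_const _

theorem memLp_height_mul_weighted {f : ℝ → ℝ} (hf : Continuous f) {m : ℝ} (hm : ∀ x, m ≤ f x)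
    {L : ℝ} (hL : 0 < L) {u : ℝ × ℝ → ℂ} (hu : LocallyL2 f u) {ζ : ℝ → ℝ} (hζ : Continuous ζ)
    {R : ℝ} (hζs : tsupport ζ ⊆ Set.Iic R) :
    MemLp (fun p : ℝ × ℝ => ((ζ p.2 : ℝ) : ℂ) * weighted f L u p) 2 := by
  have hc : Continuous fun p : ℝ × ℝ => ζ p.2 * √(periodCutoff L p.1) :=
    (hζ.comp continuous_snd).mul (continuous_sqrt_periodCutoff L)
  have h1 := memLp_cutoff_mul_zeroExt hf hm hu hc (a := 0) (b := 2 * L) (R := R) (fun p hp =>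
    ⟨tsupport_periodCutoff hL (subset_tsupport _ fun h0 => right_ne_zero_of_mul hp (by
      rw [h0, Real.sqrt_zero])), hζs (subset_tsupport _ (left_ne_zero_of_mul hp))⟩)
  have heq : (fun p : ℝ × ℝ => ((ζ p.2 : ℝ) : ℂ) * weighted f L u p) =
      fun p => ((ζ p.2 * √(periodCutoff L p.1) : ℝ) : ℂ) * zeroExt f u p := by
    funext p
    rw [weighted]; push_cast; ring
  rwa [heq]

/-- The pairing is a convolution with the reflection of `φ`, evaluated on the vertical axis. -/
theorem hasDerivAt_integral_mul_shift {A φ : ℝ × ℝ → ℂ} (hA : LocallyIntegrable A)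
    (hφ : ContDiff ℝ 1 φ) (hφc : HasCompactSupport φ) (h : ℝ) :
    HasDerivAt (fun h : ℝ => ∫ p, A p * φ (p - (0, h))) (-∫ p, A p * dy φ (p - (0, h))) h := by
  have hg : ContDiff ℝ 1 fun z => φ (-z) := hφ.comp contDiff_neg
  have hgc : HasCompactSupport fun z => φ (-z) :=
    hφc.comp_homeomorph (Homeomorph.neg (ℝ × ℝ))
  have h1 := hgc.hasFDerivAt_convolution_right (ContinuousLinearMap.mul ℝ ℂ) hA hg (0, h)
  have h2 : HasDerivAt (fun t : ℝ => ((0 : ℝ), t)) (0, 1) h :=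
    (hasDerivAt_const h (0 : ℝ)).prodMk (hasDerivAt_id h)
  have h3 := h1.comp_hasDerivAt h h2
  rw [convolution_precompR_apply _ hA (hgc.fderiv ℝ) (hg.continuous_fderiv one_ne_zero)] at h3
  have e1 : ((MeasureTheory.convolution A (fun z => φ (-z)) (ContinuousLinearMap.mul ℝ ℂ) volume) ∘
      fun t : ℝ => ((0 : ℝ), t)) = fun h : ℝ => ∫ p, A p * φ (p - (0, h)) := by
    funext t
    simp [convolution_def]
  rw [e1] at h3
  refine h3.congr_deriv ?_
  rw [convolution_def, ← integral_neg]
  congr 1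
  funext p
  have h4 : fderiv ℝ (fun z => φ (-z)) ((0, h) - p) (0, 1) = -dy φ (p - (0, h)) := by
    have h5 : HasFDerivAt (fun z => φ (-z)) ((fderiv ℝ φ (-((0, h) - p))).comp
        (-ContinuousLinearMap.id ℝ (ℝ × ℝ))) ((0, h) - p) :=
      (hφ.differentiable one_ne_zero _).hasFDerivAt.comp _ (hasFDerivAt_id _).neg
    rw [h5.fderiv, neg_sub, dy]
    simp [← map_neg]
  simp [h4]

theorem tendsto_eLpNorm_bounded_mul {F : ℝ × ℝ → ℂ} (hF : MemLp F 2)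
    {c : ℕ → ℝ → ℝ} (hc : ∀ n, Continuous (c n)) {C : ℝ} (hC : ∀ n y, |c n y| ≤ C)
    (hlim : ∀ y, Tendsto (fun n => c n y) atTop (𝓝 0)) :
    Tendsto (fun n => eLpNorm (fun p : ℝ × ℝ => ((c n p.2 : ℝ) : ℂ) * F p) 2) atTop (𝓝 0) := by
  have hm : ∀ n, MemLp (fun p : ℝ × ℝ => ((c n p.2 : ℝ) : ℂ) * F p) 2 := fun n =>
    memLp_height_mul hF (hc n) (hC n)
  have h1 := tendsto_integral_bounded_mul (integrable_mul_conj hF hF) (c := fun n y => c n y ^ 2)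
    (fun n => (hc n).pow 2) (C := C ^ 2) (fun n y => by
      rw [abs_pow]; exact pow_le_pow_left₀ (abs_nonneg _) (hC n y) 2) (c₀ := 0)
    (fun y => by simpa using (hlim y).pow 2)
  have h2 : ∀ n, ∫ p : ℝ × ℝ, ((c n p.2 ^ 2 : ℝ) : ℂ) * (F p * conj (F p)) =
      ((eLpNorm (fun p : ℝ × ℝ => ((c n p.2 : ℝ) : ℂ) * F p) 2).toReal : ℂ) ^ 2 := by
    intro n
    rw [← integral_mul_conj_self (hm n)]
    congr 1; funext p
    simp only [map_mul, Complex.conj_ofReal]; push_cast; ring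
  simp only [h2, Complex.ofReal_zero, zero_mul] at h1
  have h3 := h1.norm
  simp only [norm_pow, Complex.norm_real, norm_zero, Real.norm_eq_abs, ENNReal.abs_toReal] at h3
  have h4 := (Real.continuous_sqrt.tendsto 0).comp h3
  simp only [Function.comp_def, Real.sqrt_sq ENNReal.toReal_nonneg, Real.sqrt_zero] at h4
  rwa [← ENNReal.toReal_zero, ENNReal.tendsto_toReal_iff (fun n => (hm n).2.ne) ENNReal.zero_ne_top]
    at h4

theorem eLpNorm_height_mul_weighted_le {f : ℝ → ℝ} (hf : Continuous f) {m : ℝ}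
    (hm : ∀ x, m ≤ f x) {L : ℝ} (hL : 0 < L) (u : ℝ × ℝ → ℂ) {c : ℝ → ℝ} {C R : ℝ}
    (hC : ∀ y, |c y| ≤ C) (hcs : tsupport c ⊆ Set.Iic R) :
    eLpNorm (fun p : ℝ × ℝ => ((c p.2 : ℝ) : ℂ) * weighted f L u p) 2 ≤
      ENNReal.ofReal C * eLpNorm u 2
        (volume.restrict (region f ∩ Set.Icc 0 (2 * L) ×ˢ Set.Icc m R)) := by
  have hQm : MeasurableSet (region f ∩ Set.Icc 0 (2 * L) ×ˢ Set.Icc m R) :=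
    (measurableSet_region hf).inter (isCompact_Icc.prod isCompact_Icc).measurableSet
  rw [← eLpNorm_indicator_eq_eLpNorm_restrict hQm]
  refine eLpNorm_le_mul_eLpNorm_of_ae_le_mul (Eventually.of_forall fun p => ?_) 2
  have hC0 : 0 ≤ C := (abs_nonneg _).trans (hC 0)
  by_cases h0 : c p.2 = 0
  · simp only [h0, Complex.ofReal_zero, zero_mul, norm_zero]; positivity
  by_cases h1 : periodCutoff L p.1 = 0
  · simp only [weighted, h1, Real.sqrt_zero, Complex.ofReal_zero, zero_mul, mul_zero, norm_zero]
    positivity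
  by_cases hp : p ∈ region f
  · rw [Set.indicator_of_mem (show p ∈ region f ∩ Set.Icc 0 (2 * L) ×ˢ Set.Icc m R from
      ⟨hp, tsupport_periodCutoff hL (subset_tsupport _ h1), (hm _).trans hp,
        hcs (subset_tsupport _ h0)⟩), weighted, zeroExt, Set.indicator_of_mem hp, norm_mul,
      Complex.norm_real]
    gcongr
    exacts [hC _, norm_sqrt_periodCutoff_mul_le L p.1 _]
  · simp only [weighted, zeroExt, Set.indicator_of_notMem hp, mul_zero, norm_zero]
    positivity

theorem weighted_eq_of_eq_zero {f : ℝ → ℝ} {L : ℝ} {ψ : ℝ × ℝ → ℂ}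
    (hψ : ∀ p, p ∉ region f → ψ p = 0) (p : ℝ × ℝ) :
    weighted f L ψ p = ((√(periodCutoff L p.1) : ℝ) : ℂ) * ψ p := by
  by_cases hp : p ∈ region f
  · rw [weighted, zeroExt, Set.indicator_of_mem hp]
  · rw [weighted, zeroExt, Set.indicator_of_notMem hp, hψ p hp]

theorem IsTestFunction.height_mul {U : Set (ℝ × ℝ)} {φ : ℝ × ℝ → ℂ} (hφ : IsTestFunction U φ)
    {ζ : ℝ → ℝ} (hζ : ContDiff ℝ ∞ ζ) :
    IsTestFunction U (fun p => ((ζ p.2 : ℝ) : ℂ) * φ p) :=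
  ⟨(Complex.ofRealCLM.contDiff.comp (hζ.comp contDiff_snd)).mul hφ.smooth,
    hφ.compact.mul_left, (tsupport_mul_subset_right).trans hφ.support⟩

theorem dy_height_mul {φ : ℝ × ℝ → ℂ} {ζ : ℝ → ℝ} (hζ : Differentiable ℝ ζ)
    (hφ : Differentiable ℝ φ) (p : ℝ × ℝ) :
    dy (fun p : ℝ × ℝ => ((ζ p.2 : ℝ) : ℂ) * φ p) p =
      ((deriv ζ p.2 : ℝ) : ℂ) * φ p + ((ζ p.2 : ℝ) : ℂ) * dy φ p := by
  have h1 : HasFDerivAt (fun p : ℝ × ℝ => ((ζ p.2 : ℝ) : ℂ))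
      (Complex.ofRealCLM.comp ((ContinuousLinearMap.toSpanSingleton ℝ (deriv ζ p.2)).comp
        (ContinuousLinearMap.snd ℝ ℝ ℝ))) p :=
    Complex.ofRealCLM.hasFDerivAt.comp p
      ((hζ p.2).hasDerivAt.hasFDerivAt.comp p hasFDerivAt_snd)
  have h2 : HasFDerivAt (fun p : ℝ × ℝ => ((ζ p.2 : ℝ) : ℂ) * φ p) _ p :=
    h1.mul (hφ p).hasFDerivAt
  rw [dy, h2.fderiv]
  simp [dy]; ring

/-! ### The energy of the solution in a period -/

namespace IsGratingSolution
variable {f : ℝ → ℝ} {L k m : ℝ} {ν : ℂ} {w wx wy : ℝ × ℝ → ℂ}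

/-- The cutoff is supported in two periods; the second is controlled by the first through
quasiperiodicity. -/
theorem memLp_strip (hs : IsGratingSolution f L k m ν w wx wy) :
    MemLp ({p : ℝ × ℝ | p.1 ∈ Set.Icc 0 (2 * L)}.indicator (zeroExt f w)) 2 := by
  have hmS : ∀ S : Set ℝ, MeasurableSet S → MeasurableSet {p : ℝ × ℝ | p.1 ∈ S} :=
    fun S hS => measurable_fst hS
  have hcell : MeasurableSet (cell f L) := by
    have : cell f L = region f ∩ {p : ℝ × ℝ | p.1 ∈ Set.Icc 0 L} := by
      rfl
    rw [this]
    exact (measurableSet_region hs.cont).inter (hmS _ measurableSet_Icc)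
  have h1 : MemLp ({p : ℝ × ℝ | p.1 ∈ Set.Icc 0 L}.indicator (zeroExt f w)) 2 := by
    have h2 := (memLp_indicator_iff_restrict hcell).2 hs.memLp
    have heq : {p : ℝ × ℝ | p.1 ∈ Set.Icc 0 L}.indicator (zeroExt f w) =
        (cell f L).indicator w := by
      funext p
      by_cases hp : p ∈ region f <;> simp [zeroExt, cell, Set.indicator, hp]
    rwa [heq]
  have h2 : MemLp ({p : ℝ × ℝ | p.1 ∈ Set.Ioc 0 L}.indicator (zeroExt f w)) 2 := by
    have h3 := h1.indicator (hmS _ (measurableSet_Ioc (a := (0 : ℝ)) (b := L)))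
    have hsub : {p : ℝ × ℝ | p.1 ∈ Set.Ioc 0 L} ⊆ {p : ℝ × ℝ | p.1 ∈ Set.Icc 0 L} :=
      fun p hp => ⟨hp.1.le, hp.2⟩
    rwa [Set.indicator_indicator, Set.inter_eq_left.2 hsub] at h3
  have h3 : MemLp ({p : ℝ × ℝ | p.1 ∈ Set.Ioc L (2 * L)}.indicator (zeroExt f w)) 2 := by
    refine ((memLp_shift h2 (L, 0)).const_mul ν).ae_eq ?_
    have h4 := (measurePreserving_sub_right (volume : Measure (ℝ × ℝ))
      (L, 0)).quasiMeasurePreserving.ae (hs.quasi.ae_zeroExt hs.cont hs.periodic)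
    filter_upwards [h4] with p hp
    rw [sub_add_cancel] at hp
    have hiff : (p - (L, 0)) ∈ {p : ℝ × ℝ | p.1 ∈ Set.Ioc 0 L} ↔
        p ∈ {p : ℝ × ℝ | p.1 ∈ Set.Ioc L (2 * L)} := by
      simp only [Set.mem_ofPred_eq, Set.mem_Ioc, Prod.fst_sub]
      constructor <;> rintro ⟨h, h'⟩ <;> constructor <;> linarith
    by_cases hpm : p ∈ {p : ℝ × ℝ | p.1 ∈ Set.Ioc L (2 * L)}
    · rw [Set.indicator_of_mem hpm, Set.indicator_of_mem (hiff.2 hpm), hp]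
    · rw [Set.indicator_of_notMem hpm, Set.indicator_of_notMem (fun h => hpm (hiff.1 h)), mul_zero]
  have hdisj : Disjoint {p : ℝ × ℝ | p.1 ∈ Set.Icc 0 L} {p : ℝ × ℝ | p.1 ∈ Set.Ioc L (2 * L)} := by
    rw [Set.disjoint_left]
    intro p hp hp'
    exact absurd hp.2 (not_le.2 hp'.1)
  have hun : {p : ℝ × ℝ | p.1 ∈ Set.Icc 0 (2 * L)} =
      {p : ℝ × ℝ | p.1 ∈ Set.Icc 0 L} ∪ {p : ℝ × ℝ | p.1 ∈ Set.Ioc L (2 * L)} := by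
    ext p
    have := hs.pos
    simp only [Set.mem_Icc, Set.mem_Ioc, Set.mem_union, Set.mem_ofPred_eq]
    constructor
    · rintro ⟨h, h'⟩
      rcases le_or_gt p.1 L with hl | hl
      · exact Or.inl ⟨h, hl⟩
      · exact Or.inr ⟨hl, h'⟩
    · rintro (⟨h, h'⟩ | ⟨h, h'⟩) <;> constructor <;> linarith
  rw [hun, Set.indicator_union_of_disjoint hdisj]
  exact h1.add h3

theorem memLp_weighted (hs : IsGratingSolution f L k m ν w wx wy) : MemLp (weighted f L w) 2 := by
  have h1 := hs.memLp_strip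
  have heq : weighted f L w = fun p => ((√(periodCutoff L p.1) : ℝ) : ℂ) *
      {p : ℝ × ℝ | p.1 ∈ Set.Icc 0 (2 * L)}.indicator (zeroExt f w) p := by
    funext p
    by_cases hp : p ∈ {p : ℝ × ℝ | p.1 ∈ Set.Icc 0 (2 * L)}
    · rw [Set.indicator_of_mem hp, weighted]
    · have h2 : periodCutoff L p.1 = 0 := by
        by_contra h3
        exact hp (tsupport_periodCutoff hs.pos (subset_tsupport _ h3))
      simp [weighted, h2]
  rw [heq]
  exact h1.mono ((Complex.continuous_ofReal.comp
    (continuous_sqrt_periodCutoff L)).aestronglyMeasurable.mul h1.1)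
    (Eventually.of_forall fun p => norm_sqrt_periodCutoff_mul_le L p.1 _)

theorem integral_deriv_periodCutoff (hs : IsGratingSolution f L k m ν w wx wy) {η : ℝ → ℝ}
    (hη : Continuous η) {R : ℝ} (hηs : tsupport η ⊆ Set.Iic R) (h : ℝ) :
    ∫ p : ℝ × ℝ, (((deriv (periodCutoff L) p.1 * η p.2 : ℝ) : ℂ) * zeroExt f wx p) *
        conj (zeroExt f w (p - (0, h))) = 0 := by
  set F : ℝ × ℝ → ℂ := fun p => ((η p.2 : ℝ) : ℂ) *
    (zeroExt f wx p * conj (zeroExt f w (p - (0, h)))) with hF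
  have h1 : ∀ᵐ p : ℝ × ℝ, F (p + (L, 0)) = F p := by
    have hq := hs.quasi.ae_zeroExt hs.cont hs.periodic
    have hqh := (measurePreserving_sub_right (volume : Measure (ℝ × ℝ))
      (0, h)).quasiMeasurePreserving.ae hq
    filter_upwards [hs.quasi_x.ae_zeroExt hs.cont hs.periodic, hqh] with p hp hp'
    simp only [hF]
    rw [← sub_add_eq_add_sub, hp, hp', map_mul, Prod.snd_add, add_zero]
    linear_combination ((η p.2 : ℝ) : ℂ) * zeroExt f wx p * conj (zeroExt f w (p - (0, h))) *
      hs.unimodular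
  have hstep : Continuous (deriv (unitStep L)) := (contDiff_unitStep L).continuous_deriv (by simp)
  have hA : MemLp (fun p : ℝ × ℝ =>
      ((deriv (unitStep L) p.1 * η p.2 : ℝ) : ℂ) * zeroExt f wx p) 2 :=
    memLp_cutoff_mul_zeroExt hs.cont hs.lower hs.grad.memL2_x
      (c := fun p => deriv (unitStep L) p.1 * η p.2) (by fun_prop) (a := 0) (b := L) (R := R)
      (fun p hp => ⟨deriv_unitStep_support hs.pos (left_ne_zero_of_mul hp),
        hηs (subset_tsupport _ (right_ne_zero_of_mul hp))⟩)
  have h2 : Integrable fun p : ℝ × ℝ => ((deriv (unitStep L) p.1 : ℝ) : ℂ) * F p := by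
    refine (integrable_mul_conj hA (memLp_shift hs.memLp_strip (0, h))).congr
      (Eventually.of_forall fun p => ?_)
    by_cases hp : deriv (unitStep L) p.1 = 0
    · simp [hp]
    · have hp2 := deriv_unitStep_support hs.pos hp
      have hmem : p - (0, h) ∈ {p : ℝ × ℝ | p.1 ∈ Set.Icc 0 (2 * L)} := by
        have := hs.pos
        simp only [Set.mem_ofPred_eq, Prod.fst_sub, sub_zero, Set.mem_Icc]
        exact ⟨hp2.1, by linarith [hp2.2]⟩
      simp only [hF]
      rw [Set.indicator_of_mem hmem]
      push_cast; ring
  rw [← integral_deriv_periodCutoff_mul h1 h2]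
  congr 1
  funext p
  simp only [hF]
  push_cast; ring

theorem weighted_identity (hs : IsGratingSolution f L k m ν w wx wy) {η : ℝ → ℝ}
    (hη : ContDiff ℝ ∞ η) {R : ℝ} (hηs : tsupport η ⊆ Set.Iic R) {h : ℝ} (hh : 0 ≤ h) :
    (∫ p : ℝ × ℝ, ((deriv η p.2 : ℝ) : ℂ) *
        (weighted f L wy p * conj (weighted f L w (p - (0, h))))) +
      (∫ p : ℝ × ℝ, ((η p.2 : ℝ) : ℂ) *
        (weighted f L wx p * conj (weighted f L wx (p - (0, h))))) +
      (∫ p : ℝ × ℝ, ((η p.2 : ℝ) : ℂ) *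
        (weighted f L wy p * conj (weighted f L wy (p - (0, h))))) =
      (k : ℂ) ^ 2 * ∫ p : ℝ × ℝ, ((η p.2 : ℝ) : ℂ) *
        (weighted f L w p * conj (weighted f L w (p - (0, h)))) := by
  have h1 := tested_identity hs.cont hs.lower hs.grad hs.helmholtz hs.boundary
    (contDiff_periodCutoff L) hη (tsupport_periodCutoff hs.pos) hηs hh
  rw [hs.integral_deriv_periodCutoff hη.continuous hηs, zero_add] at h1
  have e : ∀ (c : ℝ → ℝ) (u v : ℝ × ℝ → ℂ), ∫ p : ℝ × ℝ, ((c p.2 : ℝ) : ℂ) *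
      (weighted f L u p * conj (weighted f L v (p - (0, h)))) =
      ∫ p : ℝ × ℝ, (((periodCutoff L p.1 * c p.2 : ℝ) : ℂ) * zeroExt f u p) *
        conj (zeroExt f v (p - (0, h))) := by
    intro c u v
    simp_rw [weighted_mul_conj hs.pos]
    congr 1; funext p; push_cast; ring
  simpa only [e] using h1

/-- Caccioppoli estimate: the energy of the solution below height `R`, over one period, is bounded
uniformly in `R`. -/
theorem exists_bound_height_mul_weighted (hs : IsGratingSolution f L k m ν w wx wy) :
    ∃ M : ℝ, ∀ R : ℝ,
      (eLpNorm (fun p : ℝ × ℝ => ((heightCutoff R p.2 : ℝ) : ℂ) * weighted f L wx p) 2).toReal ≤ M ∧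
      (eLpNorm (fun p : ℝ × ℝ =>
        ((heightCutoff R p.2 : ℝ) : ℂ) * weighted f L wy p) 2).toReal ≤ M := by
  obtain ⟨C, hC0, hC⟩ := exists_abs_deriv_heightCutoff_le
  set N := (eLpNorm (weighted f L w) 2).toReal with hN
  have hN0 : 0 ≤ N := ENNReal.toReal_nonneg
  -- the square root of twice `k² ‖c‖² + 2 ‖d‖²`, which is what remains once `2 ‖b‖ ‖d‖` is absorbed
  -- into `‖b‖² / 2 + 2 ‖d‖²`, with `c = ζ W`, `d = ζ' W`, `b = ζ Wy` and `ζ` the height cutoff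
  refine ⟨√(2 * k ^ 2 * N ^ 2 + 4 * C ^ 2 * N ^ 2), fun R => ?_⟩
  have hζ := contDiff_heightCutoff R
  have hζs := tsupport_heightCutoff R
  have mA := memLp_height_mul_weighted hs.cont hs.lower hs.pos hs.grad.memL2_x hζ.continuous hζs
  have mB := memLp_height_mul_weighted hs.cont hs.lower hs.pos hs.grad.memL2_y hζ.continuous hζs
  have bdd : ∀ {c : ℝ → ℝ} {K : ℝ}, Continuous c → (∀ y, |c y| ≤ K) → 0 ≤ K →
      MemLp (fun p : ℝ × ℝ => ((c p.2 : ℝ) : ℂ) * weighted f L w p) 2 ∧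
      (eLpNorm (fun p : ℝ × ℝ => ((c p.2 : ℝ) : ℂ) * weighted f L w p) 2).toReal ≤ K * N := by
    intro c K hc hK hK0
    have hle : ∀ p : ℝ × ℝ, ‖((c p.2 : ℝ) : ℂ) * weighted f L w p‖ ≤ K * ‖weighted f L w p‖ := by
      intro p
      rw [norm_mul, Complex.norm_real]
      gcongr
      exact hK p.2
    refine ⟨memLp_height_mul hs.memLp_weighted hc hK, ?_⟩
    have h1 := eLpNorm_le_mul_eLpNorm_of_ae_le_mul (Eventually.of_forall hle) 2
      (μ := (volume : Measure (ℝ × ℝ)))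
    have h2 := ENNReal.toReal_mono
      (ENNReal.mul_ne_top ENNReal.ofReal_ne_top hs.memLp_weighted.2.ne) h1
    rwa [ENNReal.toReal_mul, ENNReal.toReal_ofReal hK0] at h2
  obtain ⟨mC, bC⟩ := bdd hζ.continuous (abs_heightCutoff_le R) zero_le_one
  obtain ⟨mD, bD⟩ := bdd (hζ.continuous_deriv (by simp)) (hC R) hC0
  have hη : ContDiff ℝ ∞ fun y => heightCutoff R y ^ 2 := hζ.pow 2
  have hηs : tsupport (fun y => heightCutoff R y ^ 2) ⊆ Set.Iic (R + 1) := by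
    refine (closure_mono fun y hy => ?_).trans hζs
    exact fun h0 => hy (by simp [h0])
  have hderiv : ∀ y, deriv (fun y => heightCutoff R y ^ 2) y =
      2 * (heightCutoff R y * deriv (heightCutoff R) y) := by
    intro y
    have hd : DifferentiableAt ℝ (heightCutoff R) y := hζ.differentiable (by simp) y
    rw [deriv_fun_pow hd]; simp; ring
  have key := hs.weighted_identity hη hηs le_rfl
  simp only [Prod.mk_zero_zero, sub_zero, hderiv] at key
  have e1 : ∀ u v : ℝ × ℝ → ℂ, (∫ p : ℝ × ℝ, ((heightCutoff R p.2 ^ 2 : ℝ) : ℂ) *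
      (u p * conj (v p))) = ∫ p : ℝ × ℝ, (((heightCutoff R p.2 : ℝ) : ℂ) * u p) *
        conj (((heightCutoff R p.2 : ℝ) : ℂ) * v p) := by
    intro u v
    congr 1; funext p
    simp only [map_mul, Complex.conj_ofReal]; push_cast; ring
  have e2 : (∫ p : ℝ × ℝ, ((2 * (heightCutoff R p.2 * deriv (heightCutoff R) p.2) : ℝ) : ℂ) *
      (weighted f L wy p * conj (weighted f L w p))) =
      2 * ∫ p : ℝ × ℝ, (((heightCutoff R p.2 : ℝ) : ℂ) * weighted f L wy p) *
        conj (((deriv (heightCutoff R) p.2 : ℝ) : ℂ) * weighted f L w p) := by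
    rw [← integral_const_mul]
    congr 1; funext p
    simp only [map_mul, Complex.conj_ofReal]; push_cast; ring
  rw [e1, e1, e1, e2, integral_mul_conj_self mA, integral_mul_conj_self mB,
    integral_mul_conj_self mC] at key
  have hX := norm_integral_mul_conj_le mB mD
  set X := ∫ p : ℝ × ℝ, (((heightCutoff R p.2 : ℝ) : ℂ) * weighted f L wy p) *
        conj (((deriv (heightCutoff R) p.2 : ℝ) : ℂ) * weighted f L w p) with hXdef
  set a := (eLpNorm (fun p : ℝ × ℝ => ((heightCutoff R p.2 : ℝ) : ℂ) * weighted f L wx p) 2).toReal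
  set b := (eLpNorm (fun p : ℝ × ℝ => ((heightCutoff R p.2 : ℝ) : ℂ) * weighted f L wy p) 2).toReal
  set c := (eLpNorm (fun p : ℝ × ℝ => ((heightCutoff R p.2 : ℝ) : ℂ) * weighted f L w p) 2).toReal
  set d := (eLpNorm (fun p : ℝ × ℝ => ((deriv (heightCutoff R) p.2 : ℝ) : ℂ) *
    weighted f L w p) 2).toReal
  have ha : 0 ≤ a := ENNReal.toReal_nonneg
  have hb : 0 ≤ b := ENNReal.toReal_nonneg
  have hc : 0 ≤ c := ENNReal.toReal_nonneg
  have hd : 0 ≤ d := ENNReal.toReal_nonneg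
  have hre : 2 * X.re + a ^ 2 + b ^ 2 = k ^ 2 * c ^ 2 := by
    have := congrArg Complex.re key
    simp only [Complex.add_re, Complex.mul_re, ← Complex.ofReal_pow, Complex.ofReal_re,
      Complex.ofReal_im, Complex.re_ofNat, Complex.im_ofNat] at this
    linarith
  have hXre : -(b * (C * N)) ≤ X.re := by
    have h1 := (abs_le.1 (Complex.abs_re_le_norm X)).1
    have h2 : b * d ≤ b * (C * N) := by gcongr
    linarith
  have hcN : k ^ 2 * c ^ 2 ≤ k ^ 2 * N ^ 2 := by gcongr; linarith
  have hsum : a ^ 2 + b ^ 2 ≤ 2 * k ^ 2 * N ^ 2 + 4 * C ^ 2 * N ^ 2 := by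
    nlinarith [sq_nonneg (b - 2 * (C * N)), sq_nonneg a]
  constructor
  · exact Real.le_sqrt_of_sq_le (by nlinarith [sq_nonneg b])
  · exact Real.le_sqrt_of_sq_le (by nlinarith [sq_nonneg a])

theorem memLp_weighted_of_bound (hs : IsGratingSolution f L k m ν w wx wy) {u : ℝ × ℝ → ℂ}
    (hu : LocallyL2 f u) {M : ℝ} (hM : ∀ R : ℝ, (eLpNorm (fun p : ℝ × ℝ =>
      ((heightCutoff R p.2 : ℝ) : ℂ) * weighted f L u p) 2).toReal ≤ M) :
    MemLp (weighted f L u) 2 := by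
  have hmem : ∀ n : ℕ, MemLp (fun p : ℝ × ℝ => ((heightCutoff n p.2 : ℝ) : ℂ) *
      weighted f L u p) 2 := fun n => memLp_height_mul_weighted hs.cont hs.lower hs.pos hu
    (contDiff_heightCutoff n).continuous (tsupport_heightCutoff n)
  have hlim : ∀ p : ℝ × ℝ, Tendsto (fun n : ℕ => ((heightCutoff n p.2 : ℝ) : ℂ) *
      weighted f L u p) atTop (𝓝 (weighted f L u p)) := fun p => by
    simpa using ((Complex.continuous_ofReal.tendsto 1).comp (tendsto_heightCutoff p.2)).mul_const
      (weighted f L u p)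
  refine ⟨aestronglyMeasurable_of_tendsto_ae atTop (fun n => (hmem n).1)
    (Eventually.of_forall hlim), ?_⟩
  refine (Lp.eLpNorm_lim_le_liminf_eLpNorm (fun n => (hmem n).1) _
    (Eventually.of_forall hlim)).trans_lt ?_
  refine lt_of_le_of_lt (b := ENNReal.ofReal M) ?_ ENNReal.ofReal_lt_top
  refine liminf_le_of_le (by isBoundedDefault) fun b hb => ?_
  obtain ⟨n, hn⟩ := hb.exists
  refine hn.trans ?_
  rw [← ENNReal.ofReal_toReal (hmem n).2.ne]
  exact ENNReal.ofReal_le_ofReal (hM n)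

theorem memLp_weighted_x (hs : IsGratingSolution f L k m ν w wx wy) :
    MemLp (weighted f L wx) 2 := by
  obtain ⟨M, hM⟩ := hs.exists_bound_height_mul_weighted
  exact hs.memLp_weighted_of_bound hs.grad.memL2_x fun R => (hM R).1

theorem memLp_weighted_y (hs : IsGratingSolution f L k m ν w wx wy) :
    MemLp (weighted f L wy) 2 := by
  obtain ⟨M, hM⟩ := hs.exists_bound_height_mul_weighted
  exact hs.memLp_weighted_of_bound hs.grad.memL2_y fun R => (hM R).2

/-- The tested equation with the height cutoff removed. -/
theorem correlation_of_nonneg (hs : IsGratingSolution f L k m ν w wx wy) {h : ℝ} (hh : 0 ≤ h) :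
    (∫ p : ℝ × ℝ, weighted f L wx p * conj (weighted f L wx (p - (0, h)))) +
      (∫ p : ℝ × ℝ, weighted f L wy p * conj (weighted f L wy (p - (0, h)))) =
      (k : ℂ) ^ 2 * ∫ p : ℝ × ℝ, weighted f L w p * conj (weighted f L w (p - (0, h))) := by
  obtain ⟨C, -, hC⟩ := exists_abs_deriv_heightCutoff_le
  have m0 := hs.memLp_weighted
  have mx := hs.memLp_weighted_x
  have my := hs.memLp_weighted_y
  have lim : ∀ {u v : ℝ × ℝ → ℂ}, MemLp u 2 → MemLp v 2 →
      Tendsto (fun n : ℕ => ∫ p : ℝ × ℝ, ((heightCutoff n p.2 : ℝ) : ℂ) *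
        (u p * conj (v (p - (0, h))))) atTop (𝓝 (∫ p, u p * conj (v (p - (0, h))))) := by
    intro u v hu hv
    simpa using tendsto_integral_bounded_mul (integrable_mul_conj hu (memLp_shift hv (0, h)))
      (fun n : ℕ => (contDiff_heightCutoff n).continuous) (fun n y => abs_heightCutoff_le n y)
      tendsto_heightCutoff
  have lim' : Tendsto (fun n : ℕ => ∫ p : ℝ × ℝ, ((deriv (heightCutoff n) p.2 : ℝ) : ℂ) *
        (weighted f L wy p * conj (weighted f L w (p - (0, h))))) atTop (𝓝 0) := by
    simpa using tendsto_integral_bounded_mul (integrable_mul_conj my (memLp_shift m0 (0, h)))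
      (fun n : ℕ => (contDiff_heightCutoff n).continuous_deriv (by simp)) (fun n y => hC n y)
      tendsto_deriv_heightCutoff
  have h1 := (lim'.add (lim mx mx)).add (lim my my)
  rw [zero_add] at h1
  exact tendsto_nhds_unique (h1.congr fun n : ℕ => hs.weighted_identity (contDiff_heightCutoff n)
    (tsupport_heightCutoff n) hh) ((lim m0 m0).const_mul _)

/-! ### Vertical translates as a curve in `L²(ℝ²)` -/

/-- The upward translate by `h`, as an element of `L²(ℝ²)`. -/
noncomputable def translate {F : ℝ × ℝ → ℂ} (hF : MemLp F 2) (h : ℝ) :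
    Lp ℂ 2 (volume : Measure (ℝ × ℝ)) := (memLp_shift hF (0, h)).toLp _

theorem inner_translate {F : ℝ × ℝ → ℂ} (hF : MemLp F 2) (s t : ℝ) :
    inner ℂ (translate hF s) (translate hF t) = ∫ p, F p * conj (F (p - (0, s - t))) := by
  rw [translate, translate, inner_toLp,
    ← integral_sub_right_eq_self (fun p => F p * conj (F (p - (0, s - t)))) (0, t)]
  simp [sub_sub]

theorem gram_identity (hs : IsGratingSolution f L k m ν w wx wy) (s t : ℝ) :
    inner ℂ (translate hs.memLp_weighted_x s) (translate hs.memLp_weighted_x t) +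
      inner ℂ (translate hs.memLp_weighted_y s) (translate hs.memLp_weighted_y t) =
      (k : ℂ) ^ 2 * inner ℂ (translate hs.memLp_weighted s) (translate hs.memLp_weighted t) := by
  wlog hst : t ≤ s generalizing s t
  · have h1 := congrArg conj (this t s (le_of_not_ge hst))
    simpa only [map_add, map_mul, map_pow, Complex.conj_ofReal, inner_conj_symm] using h1
  · simp_rw [inner_translate]
    exact hs.correlation_of_nonneg (sub_nonneg.2 hst)

/-- Cutting off in height turns the local approximations given by the boundary condition into
approximations over a whole period. -/
theorem exists_smooth_approx (hs : IsGratingSolution f L k m ν w wx wy) :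
    ∃ ψ : ℕ → ℝ × ℝ → ℂ, (∀ n, IsTestFunction (interior (region f)) (ψ n)) ∧
      Tendsto (fun n => eLpNorm (weighted f L w - weighted f L (ψ n)) 2) atTop (𝓝 0) ∧
      Tendsto (fun n => eLpNorm (weighted f L wy - weighted f L (dy (ψ n))) 2) atTop (𝓝 0) := by
  have hK : ∀ n : ℕ, IsCompact (Set.Icc 0 (2 * L) ×ˢ Set.Icc m (n + 1 : ℝ)) := fun n =>
    isCompact_Icc.prod isCompact_Icc
  have hpos : ∀ n : ℕ, (0 : ℝ≥0∞) < (n : ℝ≥0∞)⁻¹ := fun n => by simp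
  choose φ hφ h0 _ hy using fun n : ℕ => hs.boundary _ (hK n) _ (hpos n)
  obtain ⟨C, hC0, hC⟩ := exists_abs_deriv_heightCutoff_le
  have hζ : ∀ n : ℕ, ContDiff ℝ ∞ (heightCutoff n) := fun n => contDiff_heightCutoff n
  have hζc : ∀ n : ℕ, Continuous (heightCutoff n) := fun n => (hζ n).continuous
  have hζ'c : ∀ n : ℕ, Continuous (deriv (heightCutoff n)) := fun n =>
    (hζ n).continuous_deriv (by simp)
  have hζs : ∀ n : ℕ, tsupport (deriv (heightCutoff n)) ⊆ Set.Iic (n + 1 : ℝ) := fun n =>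
    (closure_minimal support_deriv_subset (isClosed_tsupport _)).trans (tsupport_heightCutoff n)
  have hinv : Tendsto (fun n : ℕ => (n : ℝ≥0∞)⁻¹) atTop (𝓝 0) := ENNReal.tendsto_inv_nat_nhds_zero
  have hbdd : ∀ (n : ℕ) y, |1 - heightCutoff n y| ≤ 2 := fun n y => by
    have := abs_le.1 (abs_heightCutoff_le n y)
    rw [abs_le]; constructor <;> linarith [this.1, this.2]
  -- the part of a function that the height cutoff removes
  have htail : ∀ {F : ℝ × ℝ → ℂ}, MemLp F 2 → Tendsto (fun n : ℕ =>
      eLpNorm (fun p : ℝ × ℝ => ((1 - heightCutoff n p.2 : ℝ) : ℂ) * F p) 2) atTop (𝓝 0) :=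
    fun hF => tendsto_eLpNorm_bounded_mul hF (c := fun n y => 1 - heightCutoff n y)
      (fun n => continuous_const.sub (hζc n)) hbdd
      (fun y => by simpa using (tendsto_heightCutoff y).const_sub 1)
  have m0 := hs.memLp_weighted
  have my := hs.memLp_weighted_y
  have hcont : ∀ n, Continuous (φ n) := fun n => (hφ n).smooth.continuous
  have hcont' : ∀ n, Continuous (dy (φ n)) := fun n =>
    ((hφ n).smooth.continuous_fderiv (by simp)).clm_apply continuous_const
  have hsubloc : ∀ {u g : ℝ × ℝ → ℂ}, LocallyL2 f u → Continuous g →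
      LocallyL2 f (fun p => u p - g p) := fun hu hg K hK =>
        (hu K hK).sub (locallyL2_of_continuous hg K hK)
  have hsub : ∀ (u g : ℝ × ℝ → ℂ) p, weighted f L (fun p => u p - g p) p =
      weighted f L u p - weighted f L g p := by
    intro u g p
    by_cases hp : p ∈ region f <;> simp [weighted, zeroExt, hp]
    ring
  have hsmall0 : Tendsto (fun n : ℕ => eLpNorm (fun p : ℝ × ℝ => ((heightCutoff n p.2 : ℝ) : ℂ) *
      weighted f L (fun p => w p - φ n p) p) 2) atTop (𝓝 0) := by
    refine tendsto_of_tendsto_of_tendsto_of_le_of_le tendsto_const_nhds hinv (fun _ => zero_le)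
      fun n => ?_
    refine (eLpNorm_height_mul_weighted_le hs.cont hs.lower hs.pos _ (abs_heightCutoff_le n)
      (tsupport_heightCutoff n)).trans ?_
    rw [ENNReal.ofReal_one, one_mul]; exact h0 n
  have hsmally : Tendsto (fun n : ℕ => eLpNorm (fun p : ℝ × ℝ => ((heightCutoff n p.2 : ℝ) : ℂ) *
      weighted f L (fun p => wy p - dy (φ n) p) p) 2) atTop (𝓝 0) := by
    refine tendsto_of_tendsto_of_tendsto_of_le_of_le tendsto_const_nhds hinv (fun _ => zero_le)
      fun n => ?_
    refine (eLpNorm_height_mul_weighted_le hs.cont hs.lower hs.pos _ (abs_heightCutoff_le n)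
      (tsupport_heightCutoff n)).trans ?_
    rw [ENNReal.ofReal_one, one_mul]; exact hy n
  have hsmall1 : Tendsto (fun n : ℕ => eLpNorm (fun p : ℝ × ℝ =>
      ((deriv (heightCutoff n) p.2 : ℝ) : ℂ) * weighted f L (fun p => w p - φ n p) p) 2)
      atTop (𝓝 0) := by
    have h1 : Tendsto (fun n : ℕ => ENNReal.ofReal C * (n : ℝ≥0∞)⁻¹) atTop (𝓝 0) := by
      simpa using ENNReal.Tendsto.const_mul hinv (Or.inr (ENNReal.ofReal_ne_top (r := C)))
    refine tendsto_of_tendsto_of_tendsto_of_le_of_le tendsto_const_nhds h1 (fun _ => zero_le)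
      fun n => ?_
    refine (eLpNorm_height_mul_weighted_le hs.cont hs.lower hs.pos _ (hC n) (hζs n)).trans ?_
    gcongr
    exact h0 n
  have hslope : Tendsto (fun n : ℕ => eLpNorm (fun p : ℝ × ℝ =>
      ((deriv (heightCutoff n) p.2 : ℝ) : ℂ) * weighted f L w p) 2) atTop (𝓝 0) :=
    tendsto_eLpNorm_bounded_mul m0 hζ'c (fun n y => hC n y) tendsto_deriv_heightCutoff
  refine ⟨fun n p => ((heightCutoff n p.2 : ℝ) : ℂ) * φ n p,
    fun n => (hφ n).height_mul (hζ n), ?_, ?_⟩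
  · have hlim := (htail m0).add hsmall0
    rw [add_zero] at hlim
    refine tendsto_of_tendsto_of_tendsto_of_le_of_le tendsto_const_nhds hlim (fun _ => zero_le)
      fun n => ?_
    refine le_of_eq_of_le ?_ (eLpNorm_add_le
      (memLp_height_mul m0 (c := fun y => 1 - heightCutoff n y)
      (continuous_const.sub (hζc n)) (hbdd n)).1
      (memLp_height_mul_weighted hs.cont hs.lower hs.pos (hsubloc hs.grad.memL2 (hcont n)) (hζc n)
        (tsupport_heightCutoff n)).1 (by norm_num))
    congr 1
    funext p
    simp only [Pi.sub_apply, Pi.add_apply, hsub]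
    by_cases hp : p ∈ region f <;> simp [weighted, zeroExt, hp]
    ring
  -- `∂ψ = ζ ∂φ + ζ' φ`, and `ζ' φ = ζ' w - ζ' (w - φ)`
  · have hlim := ((htail my).add hsmally).add (hsmall1.add hslope)
    simp only [add_zero] at hlim
    refine tendsto_of_tendsto_of_tendsto_of_le_of_le tendsto_const_nhds hlim (fun _ => zero_le)
      fun n => ?_
    have a1 := (memLp_height_mul my (c := fun y => 1 - heightCutoff n y)
      (continuous_const.sub (hζc n)) (hbdd n)).1
    have a2 := (memLp_height_mul_weighted hs.cont hs.lower hs.pos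
      (hsubloc hs.grad.memL2_y (hcont' n)) (hζc n) (tsupport_heightCutoff n)).1
    have a3 := (memLp_height_mul_weighted hs.cont hs.lower hs.pos
      (hsubloc hs.grad.memL2 (hcont n)) (hζ'c n) (hζs n)).1
    have a4 := (memLp_height_mul m0 (hζ'c n) (hC n)).1
    refine le_trans ?_ ((eLpNorm_add_le (a1.add a2) (a3.sub a4) (by norm_num)).trans
      (add_le_add (eLpNorm_add_le a1 a2 (by norm_num)) (eLpNorm_sub_le a3 a4 (by norm_num))))
    refine le_of_eq (congrArg (fun F => eLpNorm F 2 volume) ?_)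
    funext p
    simp only [Pi.sub_apply, Pi.add_apply, hsub]
    by_cases hp : p ∈ region f
    · simp only [weighted, zeroExt, Set.indicator_of_mem hp, dy_height_mul
        ((hζ n).differentiable (by simp)) ((hφ n).smooth.differentiable (by simp))]
      push_cast
      ring
    · simp [weighted, zeroExt, hp]

theorem memLp_weighted_of_continuous {g : ℝ × ℝ → ℂ} (hg : Continuous g)
    (hgc : HasCompactSupport g) (hg0 : ∀ p, p ∉ region f → g p = 0) :
    MemLp (weighted f L g) 2 := by
  have hc : Continuous fun p : ℝ × ℝ => ((√(periodCutoff L p.1) : ℝ) : ℂ) :=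
    Complex.continuous_ofReal.comp (continuous_sqrt_periodCutoff L)
  have heq : weighted f L g = fun p => ((√(periodCutoff L p.1) : ℝ) : ℂ) * g p :=
    funext (weighted_eq_of_eq_zero hg0)
  rw [heq]
  exact (hc.mul hg).memLp_of_hasCompactSupport hgc.mul_left

theorem norm_translate_sub {F G : ℝ × ℝ → ℂ} (hF : MemLp F 2) (hG : MemLp G 2) (h : ℝ) :
    ‖translate hF h - translate hG h‖ = (eLpNorm (F - G) 2).toReal := by
  rw [translate, translate, ← MemLp.toLp_sub, Lp.norm_toLp, ← eLpNorm_shift (hF.sub hG) (0, h)]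
  rfl

theorem inner_translate_eq (v : Lp ℂ 2 (volume : Measure (ℝ × ℝ))) {F : ℝ × ℝ → ℂ}
    (hF : MemLp F 2) (h : ℝ) :
    inner ℂ v (translate hF h) = ∫ p, F (p - (0, h)) * conj (v p) := by
  rw [translate]
  conv_lhs => rw [← Lp.toLp_coeFn v (Lp.memLp v)]
  exact inner_toLp (Lp.memLp v) (memLp_shift hF (0, h))

theorem inner_translate_weighted (v : Lp ℂ 2 (volume : Measure (ℝ × ℝ))) {g : ℝ × ℝ → ℂ}
    (hg0 : ∀ p, p ∉ region f → g p = 0) (hg : MemLp (weighted f L g) 2) (h : ℝ) :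
    inner ℂ v (translate hg h) =
      ∫ p : ℝ × ℝ, (((√(periodCutoff L p.1) : ℝ) : ℂ) * conj (v p)) * g (p - (0, h)) := by
  rw [inner_translate_eq]
  congr 1; funext p
  rw [weighted_eq_of_eq_zero hg0]
  simp only [Prod.fst_sub, sub_zero]
  ring

theorem tendstoUniformly_inner_translate (v : Lp ℂ 2 (volume : Measure (ℝ × ℝ)))
    {F : ℝ × ℝ → ℂ} {G : ℕ → ℝ × ℝ → ℂ} (hF : MemLp F 2) (hG : ∀ n, MemLp (G n) 2)
    (hlim : Tendsto (fun n => eLpNorm (F - G n) 2) atTop (𝓝 0)) :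
    TendstoUniformly (fun n h => inner ℂ v (translate (hG n) h))
      (fun h => inner ℂ v (translate hF h)) atTop := by
  have h1 : Tendsto (fun n => ‖v‖ * (eLpNorm (F - G n) 2).toReal) atTop (𝓝 0) := by
    simpa using ((ENNReal.tendsto_toReal ENNReal.zero_ne_top).comp hlim).const_mul ‖v‖
  rw [Metric.tendstoUniformly_iff]
  intro ε hε
  filter_upwards [h1.eventually (gt_mem_nhds hε)] with n hn t
  rw [dist_eq_norm, ← inner_sub_right]
  refine (norm_inner_le_norm _ _).trans_lt ?_
  rwa [norm_translate_sub]

theorem hasDerivAt_inner_translate_of_smooth (v : Lp ℂ 2 (volume : Measure (ℝ × ℝ)))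
    {ψ : ℝ × ℝ → ℂ} (hψ : IsTestFunction (interior (region f)) ψ)
    (h0 : MemLp (weighted f L ψ) 2) (h1 : MemLp (weighted f L (dy ψ)) 2) (h : ℝ) :
    HasDerivAt (fun h => inner ℂ v (translate h0 h)) (-inner ℂ v (translate h1 h)) h := by
  have hout : ∀ p, p ∉ region f → p ∉ interior (region f) := fun p hp h => hp (interior_subset h)
  have z0 : ∀ p, p ∉ region f → ψ p = 0 := fun p hp => hψ.eq_zero (hout p hp)
  have z1 : ∀ p, p ∉ region f → dy ψ p = 0 := fun p hp => by
    rw [dy, hψ.fderiv_eq_zero (hout p hp)]; rfl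
  set A : ℝ × ℝ → ℂ := fun p => ((√(periodCutoff L p.1) : ℝ) : ℂ) * conj (v p) with hA
  have hc : Continuous fun p : ℝ × ℝ => ((√(periodCutoff L p.1) : ℝ) : ℂ) :=
    Complex.continuous_ofReal.comp (continuous_sqrt_periodCutoff L)
  have hAm : MemLp A 2 := by
    have hv : MemLp (fun p => conj (v p)) 2 := (Lp.memLp v).star
    exact hv.mono (hc.aestronglyMeasurable.mul hv.1)
      (Eventually.of_forall fun p => norm_sqrt_periodCutoff_mul_le L p.1 _)
  have key := hasDerivAt_integral_mul_shift (hAm.locallyIntegrable (by norm_num))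
    (hψ.smooth.of_le (by simp)) hψ.compact h
  have e0 := inner_translate_weighted v z0 h0
  have e1 := inner_translate_weighted v z1 h1
  simp only [e0, e1]
  exact key

/-- Weak differentiability of the curve of translates, obtained from smooth functions by a limit
that is uniform in `h`, translations being isometric. -/
theorem hasDerivAt_inner_translate (hs : IsGratingSolution f L k m ν w wx wy)
    (v : Lp ℂ 2 (volume : Measure (ℝ × ℝ))) (h : ℝ) :
    HasDerivAt (fun h => inner ℂ v (translate hs.memLp_weighted h))
      (-inner ℂ v (translate hs.memLp_weighted_y h)) h := by
  obtain ⟨ψ, hψ, l0, l1⟩ := hs.exists_smooth_approx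
  have hout : ∀ p, p ∉ region f → p ∉ interior (region f) := fun p hp h => hp (interior_subset h)
  have m0 : ∀ n, MemLp (weighted f L (ψ n)) 2 := fun n =>
    memLp_weighted_of_continuous (hψ n).smooth.continuous (hψ n).compact
      fun p hp => (hψ n).eq_zero (hout p hp)
  have m1 : ∀ n, MemLp (weighted f L (dy (ψ n))) 2 := fun n =>
    memLp_weighted_of_continuous
      (((hψ n).smooth.continuous_fderiv (by simp)).clm_apply continuous_const)
      ((hψ n).compact.fderiv_apply (𝕜 := ℝ) (0, 1))
      fun p hp => by rw [dy, (hψ n).fderiv_eq_zero (hout p hp)]; rfl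
  have u0 := tendstoUniformly_inner_translate v hs.memLp_weighted m0 l0
  have u1 := tendstoUniformly_inner_translate v hs.memLp_weighted_y m1 l1
  exact hasDerivAt_of_tendstoUniformly u1.neg
    (Eventually.of_forall fun n t => hasDerivAt_inner_translate_of_smooth v (hψ n) (m0 n) (m1 n) t)
    (fun t => u0.tendsto_at t) h

/-! ### Vanishing of the solution -/

theorem ae_eq_zero_of_le (hs : IsGratingSolution f L k m ν w wx wy) (hk : 0 ≤ k) (R : ℝ) :
    ∀ᵐ p : ℝ × ℝ, p.2 ≤ R → weighted f L w p = 0 := by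
  set V := weighted f L w with hV
  have hR : MeasurableSet {p : ℝ × ℝ | p.2 ≤ R} := measurable_snd measurableSet_Iic
  have hVR : MemLp ({p : ℝ × ℝ | p.2 ≤ R}.indicator V) 2 := hs.memLp_weighted.indicator hR
  set v := hVR.toLp _ with hv
  have hinner : ∀ h, inner ℂ v (translate hs.memLp_weighted h) =
      ∫ p, V (p - (0, h)) * conj ({p : ℝ × ℝ | p.2 ≤ R}.indicator V p) := fun h =>
    inner_toLp hVR (memLp_shift hs.memLp_weighted (0, h))
  have hnorm : ∀ h, ‖translate hs.memLp_weighted h‖ = (eLpNorm V 2).toReal := fun h => by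
    rw [translate, Lp.norm_toLp, eLpNorm_shift hs.memLp_weighted]
  -- the region lies above height `m`, so an upward shift by more than `R - m` moves the support
  -- off `{y ≤ R}`
  have hfar : ∀ h, R - m < h → inner ℂ v (translate hs.memLp_weighted h) = 0 := by
    intro h hh
    rw [hinner]
    refine integral_eq_zero_of_ae (Eventually.of_forall fun p => ?_)
    by_cases hp : p ∈ {p : ℝ × ℝ | p.2 ≤ R}
    · have hnot : p - (0, h) ∉ region f := by
        intro hmem
        have h1 : f (p - (0, h)).1 ≤ (p - (0, h)).2 := hmem
        have h2 := hs.lower (p - (0, h)).1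
        have h3 : p.2 ≤ R := hp
        simp only [Prod.snd_sub] at h1
        linarith
      simp [hV, weighted, zeroExt, hnot]
    · simp [Set.indicator_of_notMem hp]
  have h0 := inner_eq_zero_of_gram hk hs.gram_identity hs.hasDerivAt_inner_translate
    (fun h => (hnorm h).le) hfar 0
  rw [hinner] at h0
  have h1 : ∫ p, V (p - (0, 0)) * conj ({p : ℝ × ℝ | p.2 ≤ R}.indicator V p) =
      ((eLpNorm ({p : ℝ × ℝ | p.2 ≤ R}.indicator V) 2).toReal : ℂ) ^ 2 := by
    rw [← integral_mul_conj_self hVR]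
    congr 1; funext p
    by_cases hp : p ∈ {p : ℝ × ℝ | p.2 ≤ R}
    · simp only [Set.indicator_of_mem hp, Prod.mk_zero_zero, sub_zero]
    · simp [Set.indicator_of_notMem hp]
  rw [h1, sq_eq_zero_iff, Complex.ofReal_eq_zero, ENNReal.toReal_eq_zero_iff,
    or_iff_left hVR.2.ne, eLpNorm_eq_zero_iff hVR.1 (by norm_num)] at h0
  filter_upwards [h0] with p hp hpR
  rwa [Set.indicator_of_mem (show p ∈ {p : ℝ × ℝ | p.2 ≤ R} from hpR)] at hp

theorem ae_eq_zero_cell (hs : IsGratingSolution f L k m ν w wx wy) (hk : 0 ≤ k) :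
    ∀ᵐ p : ℝ × ℝ, p.1 ∈ Set.Ioc 0 L → zeroExt f w p = 0 := by
  have h1 := ae_all_iff.2 fun n : ℕ => hs.ae_eq_zero_of_le hk n
  filter_upwards [h1] with p hp hpL
  obtain ⟨n, hn⟩ := exists_nat_ge p.2
  have h2 := hp n hn
  rw [weighted, mul_eq_zero, Complex.ofReal_eq_zero] at h2
  exact h2.resolve_left (Real.sqrt_pos.2 (periodCutoff_pos hs.pos hpL.1 hpL.2)).ne'

/-- The vanishing on one period is carried to all others by quasiperiodicity, in both directions
since `ν ≠ 0`. -/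
theorem ae_eq_zero (hs : IsGratingSolution f L k m ν w wx wy) (hk : 0 ≤ k) :
    ∀ᵐ p : ℝ × ℝ, zeroExt f w p = 0 := by
  have hν : ν ≠ 0 := left_ne_zero_of_mul (hs.unimodular.symm ▸ one_ne_zero)
  have hq := hs.quasi.ae_zeroExt hs.cont hs.periodic
  have hqz : ∀ z : ℤ, ∀ᵐ p : ℝ × ℝ, zeroExt f w (p + ((z : ℝ) * L, 0) + (L, 0)) =
      ν * zeroExt f w (p + ((z : ℝ) * L, 0)) := fun z =>
    (measurePreserving_add_right (volume : Measure (ℝ × ℝ))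
      ((z : ℝ) * L, 0)).quasiMeasurePreserving.ae hq
  have hcell : ∀ z : ℤ, ∀ᵐ p : ℝ × ℝ, p.1 ∈ Set.Ioc 0 L →
      zeroExt f w (p + ((z : ℝ) * L, 0)) = 0 := by
    intro z
    induction z using Int.induction_on with
    | zero =>
      filter_upwards [hs.ae_eq_zero_cell hk] with p hp hpL
      simpa only [Int.cast_zero, zero_mul, Prod.mk_zero_zero, add_zero] using hp hpL
    | succ n ih =>
      filter_upwards [ih, hqz n] with p hp hp' hpL
      rw [hp hpL, mul_zero, add_assoc] at hp'
      convert hp' using 3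
      simp; ring
    | pred n ih =>
      filter_upwards [ih, hqz (-n - 1)] with p hp hp' hpL
      have h1 : p + (((-n - 1 : ℤ) : ℝ) * L, 0) + (L, 0) = p + (((-n : ℤ) : ℝ) * L, 0) := by
        ext <;> simp; ring
      rw [h1, hp hpL] at hp'
      exact (mul_eq_zero.1 hp'.symm).resolve_left hν
  have hshift : ∀ z : ℤ, ∀ᵐ p : ℝ × ℝ, p.1 - z * L ∈ Set.Ioc 0 L → zeroExt f w p = 0 := by
    intro z
    have := (measurePreserving_sub_right (volume : Measure (ℝ × ℝ))
      ((z : ℝ) * L, 0)).quasiMeasurePreserving.ae (hcell z)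
    filter_upwards [this] with p hp hpL
    simpa using hp (by simpa using hpL)
  filter_upwards [ae_all_iff.2 hshift] with p hp
  obtain ⟨z, hz, -⟩ := existsUnique_sub_zsmul_mem_Ioc hs.pos p.1 0
  exact hp z (by simpa using hz)

end IsGratingSolution
end PeriodicGrating

theorem lemma2p2 (L k θ : ℝ) (hL : 0 < L) (hk : 0 < k) (hθ0 : 0 < θ) (hθ1 : θ < Real.pi / 2)
    (f : ℝ → ℝ) (hf : ∃ C : NNReal, LipschitzWith C f) (hper : Function.Periodic f L)
    (w wx wy : ℝ × ℝ → ℂ)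
    (hw : MemLp w 2 (volume.restrict (PeriodicGrating.cell f L)))
    (hgrad : PeriodicGrating.HasWeakGradient f w wx wy)
    (heq : PeriodicGrating.SolvesHelmholtz f k w wx wy)
    (hbc : PeriodicGrating.VanishesOnBoundary f w wx wy)
    (hqp : PeriodicGrating.Quasiperiodic f L
      (Complex.exp (Complex.I * (k * L * Real.cos θ : ℝ))) w)
    (hqpx : PeriodicGrating.Quasiperiodic f L
      (Complex.exp (Complex.I * (k * L * Real.cos θ : ℝ))) wx) :
    w =ᵐ[volume.restrict (PeriodicGrating.region f)] 0 := by
  obtain ⟨C, hC⟩ := hf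
  obtain ⟨m, hm⟩ := (hper.isBounded_of_continuous hL.ne' hC.continuous).bddBelow
  have hν : Complex.exp (Complex.I * (k * L * Real.cos θ : ℝ)) *
      (starRingEnd ℂ) (Complex.exp (Complex.I * (k * L * Real.cos θ : ℝ))) = 1 := by
    rw [Complex.mul_conj, Complex.normSq_eq_norm_sq, mul_comm, Complex.norm_exp_ofReal_mul_I]
    simp
  have hs : PeriodicGrating.IsGratingSolution f L k m
      (Complex.exp (Complex.I * (k * L * Real.cos θ : ℝ))) w wx wy :=
    ⟨hC.continuous, fun x => hm (Set.mem_range_self x), hL, hper, hν, hw, hgrad, heq, hbc,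
      hqp, hqpx⟩
  rw [Filter.EventuallyEq, ae_restrict_iff' (PeriodicGrating.measurableSet_region hC.continuous)]
  filter_upwards [hs.ae_eq_zero hk.le] with p hp hpr
  rwa [PeriodicGrating.zeroExt, Set.indicator_of_mem hpr] at hp
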